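/- Let $T$ be a conservative ergodic measure preserving transformation of a $\sigma$-finite measure space $(X,\mathcal B,m)$. Let $\widehat T:L^1(m)\to L^1(m)$ be its transfer operator, defined by $\int_B \widehat T f\,dm=\int_{T^{-1}B} f\,dm$ for all $B\in\mathcal B$. Put $\mathcal F=\{B\in\mathcal B: 0<m(B)<\infty\}$ and $L^1_+(m)=\{f\in L^1(m): f\ge 0,\ \int_X f\,dm>0\}$, and for $A\in\mathcal F$ let $m_A(B)=m(A\cap B)/m(A)$. A set $A\in\mathcal F$ is called a *limited set with return sequence* $(a_n)_{n\ge1}$, where $a_n>0$, if $$\frac1{a_n}\sum_{k=0}^{n-1}\widehat T^k 1_A\longrightarrow m(A)\ \text{ in measure with respect to } m_A,\qquad\text{and}\qquad \operatorname*{ess\,sup}_{A}\ \frac1{a_n}\sum_{k=0}^{n-1}\widehat T^k 1_A\longrightarrow m(A)\qquad (n\to\infty);$$ it is called a *limited set* if this holds for some such sequence. The transformation $T$ is called *weakly pointwise dual ergodic* if there are constants $a_n>0$, $n\ge1$, such that for every $f\in L^1_+(m)$ $$\frac1{a_n}\sum_{k=0}^{n-1}\widehat T^k f\longrightarrow\int_X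 f\,dm\ \text{ in measure with respect to every finite measure }\nu\ll m,\qquad\text{and}\qquad \limsup_{n\to\infty}\frac1{a_n}\sum_{k=0}^{n-1}\widehat T^k f=\int_X f\,dm\ \text{ a.e. on } X.$$ **(a)** Suppose there are $A\in\mathcal F$, $f\in L^1_+(m)$ and constants $a_n>0$, $n\ge1$, such that $$\frac1{a_n}\sum_{k=0}^{n-1}\widehat T^k f\longrightarrow\int_X f\,dm\ \text{ in measure with respect to } m_A,\qquad\text{and}\qquad \limsup_{n\to\infty}\frac1{a_n}\sum_{k=0}^{n-1}\widehat T^k f=\int_X f\,dm\ \text{ a.e. on } A.$$ Then for every $\eta>0$ there is a set $A'\in\mathcal F$ with $A'\subseteq A$ and $m(A')\ge m(A)-\eta$ that is a limited set with return sequence $(a_n)_{n\ge1}$. **(b)** If $T$ has a limited set, then $T$ is weakly pointwise dual ergodic. -/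

import Mathlib

open MeasureTheory Filter Topology

noncomputable section

namespace WeakPDE

variable {X : Type*} [MeasurableSpace X]

/-- The density with respect to `m` of the image under `T` of the measure with density
`max f 0` with respect to `m`. -/
def posTransfer (m : Measure X) (T : X → X) (f : X → ℝ) (x : X) : ℝ :=
  (((m.withDensity fun y => ENNReal.ofReal (f y)).map T).rnDeriv m x).toReal

/-- The transfer operator of `T` with respect to `m`. For integrable `f` this is a version of
the (a.e. unique) integrable function with `∫_A (transferOp m T f) dm = ∫_{T⁻¹ A} f dm` for all
measurable `A`; see `integrable_transferOp`, `setIntegral_transferOp` and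
`ae_eq_transferOp`. -/
def transferOp (m : Measure X) (T : X → X) (f : X → ℝ) (x : X) : ℝ :=
  posTransfer m T f x - posTransfer m T (-f) x

theorem integrable_posTransfer {m : Measure X} {T : X → X} {f : X → ℝ}
    (hf : Integrable f m) : Integrable (posTransfer m T f) m := by
  have : IsFiniteMeasure (m.withDensity fun y => ENNReal.ofReal (f y)) :=
    isFiniteMeasure_withDensity_ofReal hf.2
  exact Measure.integrable_toReal_rnDeriv

theorem setIntegral_posTransfer {m : Measure X} [SigmaFinite m] {T : X → X}
    (hT : Measure.QuasiMeasurePreserving T m m) {f : X → ℝ} (hf : Integrable f m)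
    {A : Set X} (hA : MeasurableSet A) :
    ∫ x in A, posTransfer m T f x ∂m = ∫ x in T ⁻¹' A, max (f x) 0 ∂m := by
  have : IsFiniteMeasure (m.withDensity fun y => ENNReal.ofReal (f y)) :=
    isFiniteMeasure_withDensity_ofReal hf.2
  have hac : (m.withDensity fun y => ENNReal.ofReal (f y)).map T ≪ m :=
    ((withDensity_absolutelyContinuous m _).map hT.measurable).trans hT.absolutelyContinuous
  unfold posTransfer
  rw [Measure.setIntegral_toReal_rnDeriv hac, measureReal_def,
    Measure.map_apply hT.measurable hA, withDensity_apply _ (hT.measurable hA),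
    integral_eq_lintegral_of_nonneg_ae (f := fun x => max (f x) 0)
      (Eventually.of_forall fun x => le_max_right _ _) hf.pos_part.1.restrict]
  simp

theorem integrable_transferOp {m : Measure X} {T : X → X} {f : X → ℝ}
    (hf : Integrable f m) : Integrable (transferOp m T f) m :=
  (integrable_posTransfer hf).sub (integrable_posTransfer hf.neg)

/-- The defining property of the transfer operator. -/
theorem setIntegral_transferOp {m : Measure X} [SigmaFinite m] {T : X → X}
    (hT : Measure.QuasiMeasurePreserving T m m) {f : X → ℝ} (hf : Integrable f m)
    {A : Set X} (hA : MeasurableSet A) :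
    ∫ x in A, transferOp m T f x ∂m = ∫ x in T ⁻¹' A, f x ∂m := by
  unfold transferOp
  rw [integral_sub (integrable_posTransfer hf).integrableOn
      (integrable_posTransfer hf.neg).integrableOn,
    setIntegral_posTransfer hT hf hA, setIntegral_posTransfer hT hf.neg hA,
    ← integral_sub hf.pos_part.integrableOn hf.neg.pos_part.integrableOn]
  refine integral_congr_ae (Eventually.of_forall fun x => ?_)
  simp only [Pi.neg_apply]
  rcases le_total (f x) 0 with h | h
  · rw [max_eq_right h, max_eq_left (neg_nonneg.2 h)]; ring
  · rw [max_eq_left h, max_eq_right (neg_nonpos.2 h)]; ring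

/-- The defining property determines the transfer operator up to null sets. -/
theorem ae_eq_transferOp {m : Measure X} [SigmaFinite m] {T : X → X}
    (hT : Measure.QuasiMeasurePreserving T m m) {f g : X → ℝ} (hf : Integrable f m)
    (hg : Integrable g m)
    (h : ∀ A, MeasurableSet A → ∫ x in A, g x ∂m = ∫ x in T ⁻¹' A, f x ∂m) :
    g =ᵐ[m] transferOp m T f :=
  hg.ae_eq_of_forall_setIntegral_eq _ _ (integrable_transferOp hf) fun A hA _ => by
    rw [h A hA, setIntegral_transferOp hT hf hA]

/-- `normSum m T a f n = (1 / a n) * ∑_{k = 0}^{n - 1} T̂ᵏ f`. -/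
def normSum (m : Measure X) (T : X → X) (a : ℕ → ℝ) (f : X → ℝ) (n : ℕ) (x : X) : ℝ :=
  1 / a n * ∑ k ∈ Finset.range n, ((transferOp m T)^[k] f) x

/-- The class `L¹₊(m)`. -/
def IsL1Pos (m : Measure X) (f : X → ℝ) : Prop :=
  Integrable f m ∧ 0 ≤ᵐ[m] f ∧ 0 < ∫ x, f x ∂m

/-- The class of measurable sets of positive finite measure. -/
def finPosSets (m : Measure X) : Set (Set X) :=
  {B | MeasurableSet B ∧ 0 < m B ∧ m B < ⊤}

/-- Convergence in measure for a σ-finite `m`: convergence in measure with respect to every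
finite measure that is absolutely continuous with respect to `m`. -/
def TendstoInMeasureSigma (m : Measure X) (F : ℕ → X → ℝ) (g : X → ℝ) : Prop :=
  ∀ ν : Measure X, IsFiniteMeasure ν → ν ≪ m → TendstoInMeasure ν F atTop g

/-- Weak pointwise dual ergodicity. The upper limit is taken in the extended reals. -/
def WeaklyPointwiseDualErgodic (m : Measure X) (T : X → X) : Prop :=
  ∃ a : ℕ → ℝ, (∀ n, 1 ≤ n → 0 < a n) ∧
    (∀ f : X → ℝ, IsL1Pos m f →
      TendstoInMeasureSigma m (normSum m T a f) (fun _ => ∫ y, f y ∂m)) ∧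
    (∀ f : X → ℝ, IsL1Pos m f →
      ∀ᵐ x ∂m, limsup (fun n => (normSum m T a f n x : EReal)) atTop
        = ((∫ y, f y ∂m : ℝ) : EReal))

/-- `A` is a limited set with return sequence `a`. Here `m_A` is `m` conditioned on `A`, that
is `m_A(B) = m(B ∩ A) / m(A)`, and the supremum over `A` is the essential supremum, in the
extended reals. -/
def IsLimitedSetWith (m : Measure X) (T : X → X) (A : Set X) (a : ℕ → ℝ) : Prop :=
  A ∈ finPosSets m ∧ (∀ n, 1 ≤ n → 0 < a n) ∧
    TendstoInMeasure (ProbabilityTheory.cond m A)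
      (normSum m T a (A.indicator fun _ => 1)) atTop (fun _ => m.real A) ∧
    Tendsto (fun n => essSup (fun x => (normSum m T a (A.indicator fun _ => 1) n x : EReal))
      (m.restrict A)) atTop (𝓝 (m.real A : EReal))

/-- `A` is a limited set. -/
def IsLimitedSet (m : Measure X) (T : X → X) (A : Set X) : Prop :=
  ∃ a : ℕ → ℝ, IsLimitedSetWith m T A a

end WeakPDE

end

open MeasureTheory Filter Topology

noncomputable section

/-! Write S_n f for the sum of T̂ᵏ f over k < n. The engine is Hurewicz's ratio theorem
`tendsto_transferSum_div`: S_n f / S_n g tends a.e. to the ratio of the integrals. It carries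
convergence in measure (`tendstoInMeasure_normSum`) and upper bounds on the limsup
(`ae_limsup_normSum_le`) from one function to all others. It is proved from Hopf's maximal
inequality and the approximation of mean zero functions by coboundaries.

(a) The hypotheses on f pass to 1_B for every B ⊆ A of positive measure. Egorov makes the bound S_n
1_B ≤ a_n (m(B) + ε) uniform on a slightly smaller B', but that bound still concerns 1_B. Iterating
along a decreasing sequence of sets and intersecting cures this: on the intersection A' one has S_n
1_{A'} ≤ S_n 1_{B_k}, and m(B_k) → m(A'). Convergence in measure gives the matching lower bound for
the essential supremum.

(b) By the maximum principle `transferSum_indicator_le`, the uniform bound on A for F_n = S_n 1_A /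
a_n holds on all of X, which settles the upper half of the limsup. The integral of F_n over A
converges to m(A)². Replacing a set C by T⁻¹C changes the integral of F_n by at most m(C)/a_n → 0,
so the mean of F_n over each T⁻ʲA tends to m(A). A mean tending to the asymptotic upper bound forces
L¹ convergence there, and the sets T⁻ʲA cover X up to a null set. Ratios then give every f, and a.e.
convergent subsequences give the lower half of the limsup. -/

namespace WeakPDE

/-! ### Linearity, positivity and partial sums of the transfer operator. -/

section Operator

variable {X : Type*} [MeasurableSpace X] {m : Measure X} {T : X → X} {f g : X → ℝ}

theorem measurable_transferOp (m : Measure X) (T : X → X) (f : X → ℝ) :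
    Measurable (transferOp m T f) :=
  (Measure.measurable_rnDeriv _ _).ennreal_toReal.sub (Measure.measurable_rnDeriv _ _).ennreal_toReal

theorem transferOp_congr (h : f =ᵐ[m] g) : transferOp m T f = transferOp m T g := by
  have h1 : (m.withDensity fun y => ENNReal.ofReal (f y))
      = m.withDensity fun y => ENNReal.ofReal (g y) :=
    withDensity_congr_ae (h.mono fun x hx => by simp only [hx])
  have h2 : (m.withDensity fun y => ENNReal.ofReal ((-f) y))
      = m.withDensity fun y => ENNReal.ofReal ((-g) y) :=
    withDensity_congr_ae (h.mono fun x hx => by simp only [Pi.neg_apply, hx])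
  funext x
  simp only [transferOp, posTransfer, h1, h2]

theorem integrable_iterate_transferOp (hf : Integrable f m) (k : ℕ) :
    Integrable ((transferOp m T)^[k] f) m := by
  induction k with
  | zero => exact hf
  | succ k ih => rw [Function.iterate_succ_apply']; exact integrable_transferOp ih

theorem iterate_transferOp_congr (h : f =ᵐ[m] g) (k : ℕ) :
    (transferOp m T)^[k] f =ᵐ[m] (transferOp m T)^[k] g := by
  cases k with
  | zero => exact h
  | succ k => rw [Function.iterate_succ_apply, Function.iterate_succ_apply, transferOp_congr h]

/-- The partial sums `∑_{k < n} T̂ᵏ f`. -/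
def transferSum (m : Measure X) (T : X → X) (f : X → ℝ) (n : ℕ) (x : X) : ℝ :=
  ∑ k ∈ Finset.range n, ((transferOp m T)^[k] f) x

theorem integrable_transferSum (hf : Integrable f m) (n : ℕ) :
    Integrable (transferSum m T f n) m :=
  integrable_finsetSum _ fun k _ => integrable_iterate_transferOp hf k

theorem transferSum_succ_last (m : Measure X) (T : X → X) (f : X → ℝ) (n : ℕ) (x : X) :
    transferSum m T f (n + 1) x = transferSum m T f n x + ((transferOp m T)^[n] f) x :=
  Finset.sum_range_succ _ _

theorem transferSum_congr (h : f =ᵐ[m] g) (n : ℕ) :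
    transferSum m T f n =ᵐ[m] transferSum m T g n := by
  have := ae_all_iff.2 fun k => iterate_transferOp_congr (T := T) h k
  filter_upwards [this] with x hx
  exact Finset.sum_congr rfl fun k _ => hx k

theorem measurable_transferSum (hf : Measurable f) (n : ℕ) :
    Measurable (transferSum m T f n) := by
  refine Finset.measurable_fun_sum _ fun k _ => ?_
  cases k with
  | zero => exact hf
  | succ k => rw [Function.iterate_succ_apply']; exact measurable_transferOp _ _ _

theorem normSum_eq (a : ℕ → ℝ) (n : ℕ) (x : X) :
    normSum m T a f n x = transferSum m T f n x / a n := by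
  rw [normSum, transferSum, one_div, inv_mul_eq_div]

theorem transferSum_succ_first (n : ℕ) (x : X) :
    transferSum m T f (n + 1) x = f x + transferSum m T (transferOp m T f) n x := by
  simp only [transferSum, Finset.sum_range_succ' _ n, Function.iterate_succ_apply,
    Function.iterate_zero, id]
  ring

variable [SigmaFinite m] (hT : MeasurePreserving T m m)
include hT

theorem integral_transferOp (hf : Integrable f m) :
    ∫ x, transferOp m T f x ∂m = ∫ x, f x ∂m := by
  simpa using setIntegral_transferOp hT.quasiMeasurePreserving hf MeasurableSet.univ

theorem transferOp_add (hf : Integrable f m) (hg : Integrable g m) :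
    transferOp m T (fun x => f x + g x) =ᵐ[m] fun x => transferOp m T f x + transferOp m T g x := by
  have hq := hT.quasiMeasurePreserving
  refine (ae_eq_transferOp hq (hf.add hg)
    ((integrable_transferOp hf).add (integrable_transferOp hg)) fun A hA => ?_).symm
  simp only [Pi.add_apply]
  rw [integral_add (integrable_transferOp hf).integrableOn (integrable_transferOp hg).integrableOn,
    setIntegral_transferOp hq hf hA, setIntegral_transferOp hq hg hA,
    ← integral_add hf.integrableOn hg.integrableOn]

theorem transferOp_const_mul (hf : Integrable f m) (c : ℝ) :
    transferOp m T (fun x => c * f x) =ᵐ[m] fun x => c * transferOp m T f x := by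
  have hq := hT.quasiMeasurePreserving
  refine (ae_eq_transferOp hq (hf.const_mul c)
    ((integrable_transferOp hf).const_mul c) fun A hA => ?_).symm
  rw [integral_const_mul, integral_const_mul, setIntegral_transferOp hq hf hA]

theorem transferOp_sub (hf : Integrable f m) (hg : Integrable g m) :
    transferOp m T (fun x => f x - g x) =ᵐ[m] fun x => transferOp m T f x - transferOp m T g x := by
  have h := transferOp_add hT hf (hg.const_mul (-1))
  have e : (fun x => f x - g x) = fun x => f x + (-1) * g x := by funext x; ring
  rw [e]
  filter_upwards [h, transferOp_const_mul hT hg (-1)] with x h1 h2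
  rw [h1, h2]; ring

theorem transferOp_nonneg (hf : Integrable f m) (h : 0 ≤ᵐ[m] f) : 0 ≤ᵐ[m] transferOp m T f := by
  refine ae_nonneg_of_forall_setIntegral_nonneg (integrable_transferOp hf) fun A hA _ => ?_
  rw [setIntegral_transferOp hT.quasiMeasurePreserving hf hA]
  exact setIntegral_nonneg_of_ae h

theorem transferOp_mono (hf : Integrable f m) (hg : Integrable g m) (h : f ≤ᵐ[m] g) :
    transferOp m T f ≤ᵐ[m] transferOp m T g := by
  have h0 : 0 ≤ᵐ[m] fun x => g x - f x := h.mono fun x hx => sub_nonneg.2 hx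
  filter_upwards [transferOp_nonneg hT (hg.sub hf) h0, transferOp_sub hT hg hf] with x h1 h2
  have h3 : (0 : ℝ) ≤ transferOp m T (fun x => g x - f x) x := h1
  rw [h2] at h3
  exact sub_nonneg.1 h3

/-- Invariance of m amounts to T̂1 = 1; since constants need not be integrable, the comparison is
tested on sets of finite measure. -/
theorem transferOp_le_const (hf : Integrable f m) {c : ℝ} (h : ∀ᵐ x ∂m, f x ≤ c) :
    ∀ᵐ x ∂m, transferOp m T f x ≤ c := by
  have hsub : ∀ A, MeasurableSet A → m A < ⊤ →
      ∫ x in A, transferOp m T f x ∂m ≤ ∫ x in A, c ∂m := fun A hA hAf => by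
    rw [setIntegral_transferOp hT.quasiMeasurePreserving hf hA, setIntegral_const]
    have hf' : m (T ⁻¹' A) < ⊤ := by rwa [hT.measure_preimage hA.nullMeasurableSet]
    have : m.real A = m.real (T ⁻¹' A) := by
      simp [measureReal_def, hT.measure_preimage hA.nullMeasurableSet]
    rw [this, ← setIntegral_const]
    exact setIntegral_mono_ae hf.integrableOn (integrableOn_const hf'.ne) h
  refine ae_of_forall_measure_lt_top_ae_restrict _ fun A hA hAf => ?_
  refine ae_le_of_forall_setIntegral_le (f := transferOp m T f) (g := fun _ => c)
    (integrable_transferOp hf).restrict ?_ fun B hB _ => ?_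
  · have : IsFiniteMeasure (m.restrict A) := ⟨by simpa using hAf⟩
    exact integrable_const c
  · rw [Measure.restrict_restrict hB]
    exact hsub _ (hB.inter hA) ((measure_mono Set.inter_subset_right).trans_lt hAf)

theorem iterate_transferOp_add (hf : Integrable f m) (hg : Integrable g m) (k : ℕ) :
    (transferOp m T)^[k] (fun x => f x + g x)
      =ᵐ[m] fun x => (transferOp m T)^[k] f x + (transferOp m T)^[k] g x := by
  induction k with
  | zero => exact EventuallyEq.rfl
  | succ k ih =>
    simp only [Function.iterate_succ_apply']
    rw [transferOp_congr ih]
    exact transferOp_add hT (integrable_iterate_transferOp hf k) (integrable_iterate_transferOp hg k)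

theorem iterate_transferOp_const_mul (hf : Integrable f m) (c : ℝ) (k : ℕ) :
    (transferOp m T)^[k] (fun x => c * f x) =ᵐ[m] fun x => c * (transferOp m T)^[k] f x := by
  induction k with
  | zero => exact EventuallyEq.rfl
  | succ k ih =>
    simp only [Function.iterate_succ_apply']
    rw [transferOp_congr ih]
    exact transferOp_const_mul hT (integrable_iterate_transferOp hf k) c

theorem iterate_transferOp_mono (hf : Integrable f m) (hg : Integrable g m) (h : f ≤ᵐ[m] g) (k : ℕ) :
    (transferOp m T)^[k] f ≤ᵐ[m] (transferOp m T)^[k] g := by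
  induction k with
  | zero => exact h
  | succ k ih =>
    simp only [Function.iterate_succ_apply']
    exact transferOp_mono hT (integrable_iterate_transferOp hf k)
      (integrable_iterate_transferOp hg k) ih

theorem iterate_transferOp_nonneg (hf : Integrable f m) (h : 0 ≤ᵐ[m] f) (k : ℕ) :
    0 ≤ᵐ[m] (transferOp m T)^[k] f := by
  induction k with
  | zero => exact h
  | succ k ih =>
    simp only [Function.iterate_succ_apply']
    exact transferOp_nonneg hT (integrable_iterate_transferOp hf k) ih

theorem iterate_transferOp_le_const (hf : Integrable f m) {c : ℝ} (h : ∀ᵐ x ∂m, f x ≤ c) (k : ℕ) :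
    ∀ᵐ x ∂m, (transferOp m T)^[k] f x ≤ c := by
  induction k with
  | zero => exact h
  | succ k ih =>
    simp only [Function.iterate_succ_apply']
    exact transferOp_le_const hT (integrable_iterate_transferOp hf k) ih

theorem setIntegral_iterate_transferOp (hf : Integrable f m) (k : ℕ) {A : Set X}
    (hA : MeasurableSet A) :
    ∫ x in A, (transferOp m T)^[k] f x ∂m = ∫ x in T^[k] ⁻¹' A, f x ∂m := by
  induction k generalizing A with
  | zero => rfl
  | succ k ih =>
    rw [Function.iterate_succ_apply', setIntegral_transferOp hT.quasiMeasurePreserving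
      (integrable_iterate_transferOp hf k) hA, ih (hT.measurable hA), ← Set.preimage_comp,
      ← Function.iterate_succ']

theorem transferSum_add (hf : Integrable f m) (hg : Integrable g m) :
    ∀ᵐ x ∂m, ∀ n, transferSum m T (fun x => f x + g x) n x
      = transferSum m T f n x + transferSum m T g n x := by
  filter_upwards [ae_all_iff.2 (iterate_transferOp_add hT hf hg)] with x hx n
  simp only [transferSum, ← Finset.sum_add_distrib]
  exact Finset.sum_congr rfl fun k _ => hx k

theorem transferSum_const_mul (hf : Integrable f m) (c : ℝ) :
    ∀ᵐ x ∂m, ∀ n, transferSum m T (fun x => c * f x) n x = c * transferSum m T f n x := by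
  filter_upwards [ae_all_iff.2 (iterate_transferOp_const_mul hT hf c)] with x hx n
  simp only [transferSum, Finset.mul_sum]
  exact Finset.sum_congr rfl fun k _ => hx k

theorem transferSum_sub (hf : Integrable f m) (hg : Integrable g m) :
    ∀ᵐ x ∂m, ∀ n, transferSum m T (fun x => f x - g x) n x
      = transferSum m T f n x - transferSum m T g n x := by
  have e : (fun x => f x - g x) = fun x => f x + (-1) * g x := by funext x; ring
  rw [e]
  filter_upwards [transferSum_add hT hf (hg.const_mul (-1)), transferSum_const_mul hT hg (-1)]
    with x h1 h2 n
  rw [h1, h2]; ring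

theorem transferSum_mono (hf : Integrable f m) (hg : Integrable g m) (h : f ≤ᵐ[m] g) :
    ∀ᵐ x ∂m, ∀ n, transferSum m T f n x ≤ transferSum m T g n x := by
  filter_upwards [ae_all_iff.2 (iterate_transferOp_mono hT hf hg h)] with x hx n
  exact Finset.sum_le_sum fun k _ => hx k

theorem transferSum_nonneg (hf : Integrable f m) (h : 0 ≤ᵐ[m] f) :
    ∀ᵐ x ∂m, ∀ n, 0 ≤ transferSum m T f n x := by
  filter_upwards [ae_all_iff.2 (iterate_transferOp_nonneg hT hf h)] with x hx n
  exact Finset.sum_nonneg fun k _ => hx k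

theorem monotone_transferSum (hf : Integrable f m) (h : 0 ≤ᵐ[m] f) :
    ∀ᵐ x ∂m, Monotone fun n => transferSum m T f n x := by
  filter_upwards [ae_all_iff.2 (iterate_transferOp_nonneg hT hf h)] with x hx
  refine monotone_nat_of_le_succ fun n => ?_
  rw [transferSum_succ_last]
  exact le_add_of_nonneg_right (hx n)

theorem transferOp_transferSum (hf : Integrable f m) (n : ℕ) :
    transferOp m T (transferSum m T f n) =ᵐ[m] transferSum m T (transferOp m T f) n := by
  induction n with
  | zero =>
    have := transferOp_const_mul hT hf 0
    have e : transferSum m T f 0 = fun x => 0 * f x := by funext x; simp [transferSum]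
    rw [e]
    filter_upwards [this] with x hx
    rw [hx]; simp [transferSum]
  | succ n ih =>
    have e : transferSum m T f (n + 1)
        = fun x => transferSum m T f n x + (transferOp m T)^[n] f x :=
      funext fun x => transferSum_succ_last m T f n x
    rw [e]
    filter_upwards [transferOp_add hT (integrable_transferSum hf n)
      (integrable_iterate_transferOp hf n), ih] with x h1 h2
    rw [h1, h2, transferSum_succ_last, ← Function.iterate_succ_apply' (transferOp m T),
      Function.iterate_succ_apply]

theorem transferSum_succ (hf : Integrable f m) (n : ℕ) :
    transferSum m T f (n + 1) =ᵐ[m] fun x => f x + transferOp m T (transferSum m T f n) x := by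
  filter_upwards [transferOp_transferSum hT hf n] with x hx
  rw [hx, transferSum_succ_first]

theorem transferSum_coboundary (hf : Integrable f m) :
    ∀ᵐ x ∂m, ∀ n, transferSum m T (fun x => f x - transferOp m T f x) n x
      = f x - (transferOp m T)^[n] f x := by
  filter_upwards [transferSum_sub hT hf (integrable_transferOp hf)] with x hx n
  have h1 := transferSum_succ_first (m := m) (T := T) (f := f) n x
  have h2 := transferSum_succ_last m T f n x
  rw [hx]
  linarith

end Operator

/-! ### Recurrence, Hopf's maximal inequality and Hurewicz's ratio theorem. -/

section Ratio

variable {X : Type*} [MeasurableSpace X] {m : Measure X} {T : X → X} {f g : X → ℝ}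

/-- The set of points visiting B infinitely often is invariant, hence null or conull, and by
recurrence it contains almost all of B. -/
theorem ae_frequently_iterate_mem (hcons : Conservative T m) (herg : Ergodic T m) {B : Set X}
    (hB : MeasurableSet B) (hB0 : m B ≠ 0) : ∀ᵐ x ∂m, ∃ᶠ n in atTop, T^[n] x ∈ B := by
  have hmeas : MeasurableSet {x | ∃ᶠ n in atTop, T^[n] x ∈ B} := by
    have : {x | ∃ᶠ n in atTop, T^[n] x ∈ B} = limsup (fun n => T^[n] ⁻¹' B) atTop := by
      ext x
      simp [mem_limsup_iff_frequently_mem]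
    rw [this]
    exact MeasurableSet.measurableSet_limsup fun n => herg.measurable.iterate n hB
  have hinv : T ⁻¹' {x | ∃ᶠ n in atTop, T^[n] x ∈ B} = {x | ∃ᶠ n in atTop, T^[n] x ∈ B} := by
    ext x
    have h1 : (∃ᶠ n in atTop, T^[n] x ∈ B) ↔ ∃ᶠ n in atTop, T^[n + 1] x ∈ B := by
      conv_lhs => rw [← map_add_atTop_eq_nat 1, frequently_map]
    exact h1.symm
  rcases herg.toPreErgodic.ae_mem_or_ae_notMem hmeas hinv with h | h
  · exact h
  · exfalso
    apply hB0
    rw [measure_eq_zero_iff_ae_notMem]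
    filter_upwards [h, hcons.ae_mem_imp_frequently_image_mem hB.nullMeasurableSet] with x h1 h2 h3
    exact h1 (h2 h3)

theorem ae_tendsto_zero_of_sum_integral_le {F : ℕ → X → ℝ} (hF : ∀ n, Integrable (F n) m)
    (h0 : ∀ n x, 0 ≤ F n x) {C : ℝ} (hC : ∀ N, ∑ n ∈ Finset.range N, ∫ x, F n x ∂m ≤ C) :
    ∀ᵐ x ∂m, Tendsto (fun n => F n x) atTop (𝓝 0) := by
  have hlt : ∫⁻ x, ∑' n, ENNReal.ofReal (F n x) ∂m ≠ ⊤ := by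
    rw [lintegral_tsum fun n => (hF n).1.aemeasurable.ennreal_ofReal]
    refine ne_top_of_le_ne_top (ENNReal.ofReal_ne_top (r := C)) ?_
    refine ENNReal.tsum_le_of_sum_range_le fun N => ?_
    simp_rw [← ofReal_integral_eq_lintegral_ofReal (hF _) (Eventually.of_forall (h0 _))]
    rw [← ENNReal.ofReal_sum_of_nonneg fun n _ => integral_nonneg (h0 n)]
    exact ENNReal.ofReal_le_ofReal (hC N)
  filter_upwards [ae_lt_top' (AEMeasurable.tsum
    fun n => (hF n).1.aemeasurable.ennreal_ofReal) hlt] with x hx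
  have h1 := ENNReal.tendsto_atTop_zero_of_tsum_ne_top hx.ne
  have h2 := (ENNReal.tendsto_toReal (ENNReal.zero_ne_top)).comp h1
  refine (h2.congr fun n => ?_)
  simp [ENNReal.toReal_ofReal (h0 n x)]

variable [SigmaFinite m]

/-- If the sums stayed below K on a set C with 0 < m(C) < ∞, then ∑ ∫ f·1_{T⁻ⁿC} ≤ K m(C), so
f·1_{T⁻ⁿC} → 0 a.e.; as almost every orbit visits C infinitely often, f would vanish a.e. -/
theorem tendsto_transferSum_atTop (hcons : Conservative T m) (herg : Ergodic T m)
    (hf : Integrable f m) (h0 : 0 ≤ᵐ[m] f) (hpos : 0 < ∫ x, f x ∂m) :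
    ∀ᵐ x ∂m, Tendsto (fun n => transferSum m T f n x) atTop atTop := by
  have hT := herg.toMeasurePreserving
  -- The term k = 0 of the sum is f itself, so a measurable version is needed for the level sets to
  -- be measurable.
  obtain ⟨f', hf'm, hff'⟩ := hf.1.aemeasurable
  have hf' : Integrable f' m := hf.congr hff'
  have hbdd : ∀ (K J : ℕ),
      m ({x | ∀ n, transferSum m T f' n x ≤ K} ∩ spanningSets m J) = 0 := by
    intro K J
    set C := {x | ∀ n, transferSum m T f' n x ≤ K} ∩ spanningSets m J with hCdef
    have hC : MeasurableSet C := by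
      refine MeasurableSet.inter ?_ (measurableSet_spanningSets m J)
      simp only [Set.ofPred_forall]
      exact MeasurableSet.iInter fun n => measurableSet_le (measurable_transferSum hf'm n)
        measurable_const
    have hCf : m C < ⊤ := (measure_mono Set.inter_subset_right).trans_lt
      (measure_spanningSets_lt_top m J)
    by_contra hne
    have hfreq := ae_frequently_iterate_mem hcons herg hC hne
    have hsum : ∀ N, ∑ n ∈ Finset.range N, ∫ x, (T^[n] ⁻¹' C).indicator (fun x => |f x|) x ∂m
        ≤ K * m.real C := by
      intro N
      have e : ∀ n, ∫ x, (T^[n] ⁻¹' C).indicator (fun x => |f x|) x ∂m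
          = ∫ x in C, (transferOp m T)^[n] f' x ∂m := by
        intro n
        rw [integral_indicator (hT.measurable.iterate n hC), setIntegral_iterate_transferOp hT hf' n hC]
        refine setIntegral_congr_ae (hT.measurable.iterate n hC) ?_
        filter_upwards [h0, hff'] with x h1 h2 _
        rw [← h2]; exact abs_of_nonneg h1
      simp_rw [e]
      rw [← integral_finsetSum _ fun n _ => (integrable_iterate_transferOp hf' n).integrableOn]
      have : ∫ x in C, (K : ℝ) ∂m = K * m.real C := by simp [mul_comm]
      rw [← this]
      exact setIntegral_mono_on (integrable_transferSum hf' N).integrableOn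
        (integrableOn_const hCf.ne) hC fun x hx => hx.1 N
    have hz := ae_tendsto_zero_of_sum_integral_le
      (fun n => hf.abs.indicator (hT.measurable.iterate n hC))
      (fun n x => Set.indicator_nonneg (fun x _ => abs_nonneg _) x) hsum
    have hf0 : f =ᵐ[m] 0 := by
      filter_upwards [hfreq, hz] with x h1 h2
      by_contra hx
      have h3 := h2.eventually (gt_mem_nhds (abs_pos.2 hx))
      obtain ⟨n, hn1, hn2⟩ := (h1.and_eventually h3).exists
      rw [Set.indicator_of_mem (show x ∈ T^[n] ⁻¹' C from hn1)] at hn2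
      exact lt_irrefl _ hn2
    rw [integral_congr_ae hf0] at hpos
    simp at hpos
  have hae : ∀ᵐ x ∂m, ∀ K : ℕ, ∃ n, (K : ℝ) < transferSum m T f' n x := by
    refine ae_all_iff.2 fun K => ?_
    have h1 : ∀ᵐ x ∂m, ∀ J, x ∉ {x | ∀ n, transferSum m T f' n x ≤ K} ∩ spanningSets m J :=
      ae_all_iff.2 fun J => measure_eq_zero_iff_ae_notMem.1 (hbdd K J)
    filter_upwards [h1] with x hx
    by_contra! hcon
    obtain ⟨J, hJ⟩ := Set.mem_iUnion.1 (iUnion_spanningSets m ▸ Set.mem_univ x :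
      x ∈ ⋃ i, spanningSets m i)
    exact hx J ⟨hcon, hJ⟩
  filter_upwards [hae, monotone_transferSum hT hf h0,
    ae_all_iff.2 fun n => transferSum_congr (T := T) hff' n] with x h1 h2 h3
  refine tendsto_atTop_atTop_of_monotone h2 fun b => ?_
  obtain ⟨K, hK⟩ := exists_nat_ge b
  obtain ⟨n, hn⟩ := h1 K
  exact ⟨n, hK.trans (by rw [h3]; exact hn.le)⟩

/-- Hopf's maximal inequality. -/
theorem exists_setIntegral_nonneg_of_transferSum_pos (hT : MeasurePreserving T m m)
    (hf : Integrable f m) :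
    ∃ E, MeasurableSet E ∧ (∀ᵐ x ∂m, ∀ n, 0 < transferSum m T f n x → x ∈ E) ∧
      0 ≤ ∫ x in E, f x ∂m := by
  obtain ⟨f', hf'm, hff'⟩ := hf.1.aemeasurable
  have hf' : Integrable f' m := hf.congr hff'
  -- This recursion dominates the partial sums because T̂ is positive. The set E will be the union
  -- of the sets {M k > 0}; it only needs to contain the sets where a partial sum is positive.
  let M : ℕ → X → ℝ := fun k => Nat.rec (fun _ => 0) (fun _ u x => max 0 (f' x + transferOp m T u x)) k
  have hMs : ∀ k x, M (k + 1) x = max 0 (f' x + transferOp m T (M k) x) := fun _ _ => rfl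
  have hM0 : ∀ k x, 0 ≤ M k x := by
    intro k x
    cases k with
    | zero => exact le_rfl
    | succ k => exact le_max_left _ _
  have hMi : ∀ k, Integrable (M k) m := by
    intro k
    induction k with
    | zero => exact integrable_zero _ _ _
    | succ k ih =>
      exact (integrable_zero X ℝ m).sup (hf'.add (integrable_transferOp ih))
  have hMm : ∀ k, Measurable (M k) := by
    intro k
    cases k with
    | zero => exact measurable_const
    | succ k => exact measurable_const.max (hf'm.add (measurable_transferOp _ _ _))
  have hstep : ∀ k, M k ≤ᵐ[m] M (k + 1) := by
    intro k
    induction k with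
    | zero => exact Eventually.of_forall fun x => hM0 1 x
    | succ k ih =>
      filter_upwards [transferOp_mono hT (hMi k) (hMi (k + 1)) ih] with x hx
      rw [hMs, hMs (k + 1)]
      exact max_le_max le_rfl (add_le_add le_rfl hx)
  have hmono : ∀ᵐ x ∂m, Monotone fun k => M k x := by
    filter_upwards [ae_all_iff.2 hstep] with x hx using monotone_nat_of_le_succ hx
  have hSM : ∀ n, transferSum m T f' n ≤ᵐ[m] M n := by
    intro n
    induction n with
    | zero => exact Eventually.of_forall fun x => by simp [transferSum, M]
    | succ n ih =>
      filter_upwards [transferOp_mono hT (integrable_transferSum hf' n) (hMi n) ih,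
        transferSum_succ hT hf' n] with x h1 h2
      rw [h2, hMs]
      exact (add_le_add le_rfl h1).trans (le_max_right _ _)
  let E : ℕ → Set X := fun k => {x | 0 < M k x}
  have hE : ∀ k, MeasurableSet (E k) := fun k => measurableSet_lt measurable_const (hMm k)
  have hEk : ∀ k, 0 ≤ ∫ x in E (k + 1), f' x ∂m := by
    intro k
    rw [← integral_indicator (hE (k + 1))]
    have h1 : 0 ≤ ∫ x, (M (k + 1) x - transferOp m T (M k) x) ∂m := by
      rw [integral_sub (hMi (k + 1)) (integrable_transferOp (hMi k)),
        integral_transferOp hT (hMi k)]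
      exact sub_nonneg.2 (integral_mono_ae (hMi k) (hMi (k + 1)) (hstep k))
    -- Where M (k+1) > 0 the integrand M (k+1) - T̂ (M k) equals f'; elsewhere it is -T̂ (M k) ≤ 0.
    refine h1.trans (integral_mono_ae ((hMi (k + 1)).sub (integrable_transferOp (hMi k)))
      (hf'.indicator (hE (k + 1))) ?_)
    filter_upwards [transferOp_nonneg hT (hMi k) (Eventually.of_forall (hM0 k))] with x hx
    have hx : 0 ≤ transferOp m T (M k) x := hx
    by_cases hxE : x ∈ E (k + 1)
    · rw [Set.indicator_of_mem hxE]
      have h2 : 0 < M (k + 1) x := hxE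
      rw [hMs, lt_max_iff] at h2
      rw [hMs, max_eq_right (by grind)]
      linarith
    · rw [Set.indicator_of_notMem hxE]
      have h2 : ¬ 0 < M (k + 1) x := hxE
      linarith
  have hlim : Tendsto (fun k => ∫ x, (E (k + 1)).indicator f' x ∂m) atTop
      (𝓝 (∫ x, (⋃ k, E k).indicator f' x ∂m)) := by
    refine tendsto_integral_of_dominated_convergence (fun x => |f' x|)
      (fun k => (hf'.indicator (hE (k + 1))).1) hf'.abs
      (fun k => Eventually.of_forall fun x => norm_indicator_le_norm_self f' x) ?_
    filter_upwards [hmono] with x hx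
    by_cases hxE : x ∈ ⋃ k, E k
    · obtain ⟨k0, hk0⟩ := Set.mem_iUnion.1 hxE
      refine tendsto_const_nhds.congr' ?_
      filter_upwards [eventually_ge_atTop k0] with k hk
      have h3 : x ∈ E (k + 1) := lt_of_lt_of_le (show 0 < M k0 x from hk0) (hx (show k0 ≤ k + 1 by omega))
      rw [Set.indicator_of_mem hxE, Set.indicator_of_mem h3]
    · refine tendsto_const_nhds.congr fun k => ?_
      rw [Set.indicator_of_notMem hxE,
        Set.indicator_of_notMem (s := E (k + 1)) fun h => hxE (Set.mem_iUnion.2 ⟨k + 1, h⟩)]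
  refine ⟨⋃ k, E k, MeasurableSet.iUnion hE, ?_, ?_⟩
  · filter_upwards [ae_all_iff.2 hSM, ae_all_iff.2 fun n => transferSum_congr (T := T) hff' n]
      with x h1 h2 n hn
    rw [h2] at hn
    exact Set.mem_iUnion.2 ⟨n, hn.trans_le (h1 n)⟩
  · rw [integral_congr_ae (ae_restrict_of_ae hff'), ← integral_indicator (MeasurableSet.iUnion hE)]
    refine ge_of_tendsto' hlim fun k => ?_
    rw [integral_indicator (hE (k + 1))]
    exact hEk k

/-- A mean zero function is, up to an arbitrarily small error in `L¹`, a coboundary with a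
nonnegative transfer function. -/
theorem exists_coboundary_approx (hcons : Conservative T m) (herg : Ergodic T m)
    (hf : Integrable f m) (hzero : ∫ x, f x ∂m = 0) {δ : ℝ} (hδ : 0 < δ) :
    ∃ g h : X → ℝ, Integrable g m ∧ Integrable h m ∧ 0 ≤ᵐ[m] g ∧ ∫ x, |h x| ∂m < δ ∧
      f =ᵐ[m] fun x => h x + (g x - transferOp m T g x) := by
  have hT := herg.toMeasurePreserving
  obtain ⟨f', hf'm, hff'⟩ := hf.1.aemeasurable
  have hf' : Integrable f' m := hf.congr hff'
  -- Filling scheme: T̂ moves the positive part, which then fills the holes left by the negative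
  -- part. Since h n - h (n+1) = (h n)⁺ - T̂ (h n)⁺, the transfer function accumulates the functions
  -- (h i)⁺.
  let h : ℕ → X → ℝ := fun n =>
    Nat.rec f' (fun _ u x => transferOp m T (fun y => max (u y) 0) x - max (-u x) 0) n
  have hs : ∀ n x, h (n + 1) x = transferOp m T (fun y => max (h n y) 0) x - max (-h n x) 0 :=
    fun _ _ => rfl
  have hi : ∀ n, Integrable (h n) m := by
    intro n
    induction n with
    | zero => exact hf'
    | succ n ih => exact (integrable_transferOp ih.pos_part).sub ih.neg_part
  have hm : ∀ n, Measurable (h n) := by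
    intro n
    induction n with
    | zero => exact hf'm
    | succ n ih => exact (measurable_transferOp _ _ _).sub (ih.neg.max measurable_const)
  have hPn : ∀ᵐ x ∂m, ∀ n, 0 ≤ transferOp m T (fun y => max (h n y) 0) x :=
    ae_all_iff.2 fun n => transferOp_nonneg hT (hi n).pos_part
      (Eventually.of_forall fun x => le_max_right _ _)
  have hanti : ∀ᵐ x ∂m, Antitone fun n => max (-h n x) 0 := by
    filter_upwards [hPn] with x hx
    refine antitone_nat_of_succ_le fun n => ?_
    have := hx n
    rw [hs]
    refine max_le ?_ (le_max_right _ _)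
    linarith
  have hint : ∀ n, ∫ x, h n x ∂m = 0 := by
    intro n
    induction n with
    | zero => rw [← hzero]; exact integral_congr_ae hff'.symm
    | succ n ih =>
      have : ∫ x, h (n + 1) x ∂m = ∫ x, max (h n x) 0 ∂m - ∫ x, max (-h n x) 0 ∂m := by
        rw [← integral_transferOp hT (hi n).pos_part,
          ← integral_sub (integrable_transferOp (hi n).pos_part) (hi n).neg_part]
      rw [this, ← integral_sub (hi n).pos_part (hi n).neg_part]
      refine Eq.trans ?_ ih
      refine integral_congr_ae (Eventually.of_forall fun x => ?_)
      change max (h n x) 0 - max (-h n x) 0 = h n x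
      rcases le_total (h n x) 0 with hx | hx
      · rw [max_eq_right hx, max_eq_left (neg_nonneg.2 hx)]; ring
      · rw [max_eq_left hx, max_eq_right (neg_nonpos.2 hx)]; ring
  have hpn : ∀ n, ∫ x, max (h n x) 0 ∂m = ∫ x, max (-h n x) 0 ∂m := by
    intro n
    rw [← sub_eq_zero, ← integral_sub (hi n).pos_part (hi n).neg_part]
    refine Eq.trans ?_ (hint n)
    refine integral_congr_ae (Eventually.of_forall fun x => ?_)
    change max (h n x) 0 - max (-h n x) 0 = h n x
    rcases le_total (h n x) 0 with hx | hx
    · rw [max_eq_right hx, max_eq_left (neg_nonneg.2 hx)]; ring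
    · rw [max_eq_left hx, max_eq_right (neg_nonpos.2 hx)]; ring
  -- A hole B that stays at depth d forever would absorb all mass that reaches it. Almost every
  -- orbit reaches B, so ∫ (h n)⁺ → 0; yet ∫ (h n)⁺ = ∫ (h n)⁻ ≥ d m(B).
  have hB : ∀ k : ℕ, m {x | ∀ n, h n x ≤ -(1 / ((k : ℝ) + 1))} = 0 := by
    intro k
    set d : ℝ := 1 / ((k : ℝ) + 1) with hd
    have hdpos : 0 < d := Nat.one_div_pos_of_nat
    set B := {x | ∀ n, h n x ≤ -d} with hBdef
    have hBm : MeasurableSet B := by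
      rw [hBdef]
      simp only [Set.ofPred_forall]
      exact MeasurableSet.iInter fun n => measurableSet_le (hm n) measurable_const
    by_contra hne
    let D : ℕ → Set X := fun j => {x | ∀ i ≤ j, T^[i] x ∉ B}
    have hDm : ∀ j, MeasurableSet (D j) := by
      intro j
      simp only [D, Set.ofPred_forall]
      exact MeasurableSet.iInter fun i => MeasurableSet.iInter fun _ =>
        (hT.measurable.iterate i hBm).compl
    have hz : ∀ n, ∀ x ∈ B, max (h n x) 0 = 0 := fun n x hx =>
      max_eq_right ((hx n).trans (neg_nonpos.2 hdpos.le))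
    have hstep : ∀ n j, ∫ x in D j, max (h (n + 1) x) 0 ∂m
        ≤ ∫ x in D (j + 1), max (h n x) 0 ∂m := by
      intro n j
      have h1 : ∫ x in D j, max (h (n + 1) x) 0 ∂m
          ≤ ∫ x in D j, transferOp m T (fun y => max (h n y) 0) x ∂m := by
        refine setIntegral_mono_ae (hi (n + 1)).pos_part.integrableOn
          (integrable_transferOp (hi n).pos_part).integrableOn ?_
        filter_upwards [hPn] with x hx
        refine max_le ?_ (hx n)
        rw [hs]
        exact sub_le_self _ (le_max_right _ _)
      refine h1.trans (le_of_eq ?_)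
      rw [setIntegral_transferOp hT.quasiMeasurePreserving (hi n).pos_part (hDm j)]
      -- The points of T⁻¹(D j) outside D (j+1) lie in B, where (h n)⁺ vanishes.
      have hsub : D (j + 1) ⊆ T ⁻¹' D j := fun x hx i hij => by
        rw [← Function.iterate_succ_apply]
        exact hx (i + 1) (by omega)
      refine (setIntegral_eq_of_subset_of_forall_sdiff_eq_zero (hT.measurable (hDm j)) hsub ?_)
      intro x hx
      apply hz
      refine Classical.by_contradiction fun hxB => ?_
      refine hx.2 fun i hij => ?_
      cases i with
      | zero => exact hxB
      | succ i =>
        rw [Function.iterate_succ_apply]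
        exact hx.1 i (by omega)
    have hle : ∀ n j, ∫ x in D j, max (h n x) 0 ∂m ≤ ∫ x in D (j + n), max (f' x) 0 ∂m := by
      intro n
      induction n with
      | zero => exact fun j => le_rfl
      | succ n ih =>
        intro j
        refine (hstep n j).trans ((ih (j + 1)).trans (le_of_eq ?_))
        rw [show j + 1 + n = j + (n + 1) by ring]
    have hle0 : ∀ n, ∫ x, max (h n x) 0 ∂m ≤ ∫ x in D n, max (f' x) 0 ∂m := by
      intro n
      have h1 := hle n 0
      rw [zero_add] at h1
      refine le_trans (le_of_eq ?_) h1
      symm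
      refine setIntegral_eq_integral_of_forall_compl_eq_zero fun x hx => hz n x ?_
      refine Classical.by_contradiction fun hxB => ?_
      refine hx fun i hi0 => ?_
      obtain rfl : i = 0 := by omega
      exact hxB
    have hlim : Tendsto (fun n => ∫ x, (D n).indicator (fun x => max (f' x) 0) x ∂m) atTop
        (𝓝 (∫ x, (0 : ℝ) ∂m)) := by
      refine tendsto_integral_of_dominated_convergence (fun x => max (f' x) 0)
        (fun k => (hf'.pos_part.indicator (hDm _)).1) hf'.pos_part
        (fun k => Eventually.of_forall fun x => ?_) ?_
      · refine (norm_indicator_le_norm_self _ x).trans (le_of_eq ?_)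
        exact Real.norm_of_nonneg (le_max_right _ _)
      · filter_upwards [ae_frequently_iterate_mem hcons herg hBm hne] with x hx
        obtain ⟨i, hi⟩ := hx.exists
        refine tendsto_const_nhds.congr' ?_
        filter_upwards [eventually_ge_atTop i] with n hn
        rw [Set.indicator_of_notMem]
        exact fun hxD => hxD i hn hi
    rw [integral_zero] at hlim
    have hlow : ∀ n, d * m.real B ≤ ∫ x, (D n).indicator (fun x => max (f' x) 0) x ∂m := by
      intro n
      rw [integral_indicator (hDm n)]
      refine le_trans ?_ (hle0 n)
      rw [hpn n]
      refine le_trans ?_ (mul_meas_ge_le_integral_of_nonneg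
        (Eventually.of_forall fun x => le_max_right _ _) (hi n).neg_part d)
      refine mul_le_mul_of_nonneg_left ?_ hdpos.le
      refine measureReal_mono (fun x hx => ?_) ((hi n).neg_part.measure_ge_lt_top hdpos).ne
      exact le_max_of_le_left (le_neg_of_le_neg (hx n))
    have hBf : m B < ⊤ := by
      refine (measure_mono fun x hx => ?_).trans_lt ((hi 0).neg_part.measure_ge_lt_top hdpos)
      exact le_max_of_le_left (le_neg_of_le_neg (hx 0))
    have hpos : 0 < d * m.real B := mul_pos hdpos (ENNReal.toReal_pos hne hBf.ne)
    exact absurd (ge_of_tendsto' hlim hlow) (not_le.2 hpos)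
  have hneg : Tendsto (fun n => ∫ x, max (-h n x) 0 ∂m) atTop (𝓝 (∫ x, (0 : ℝ) ∂m)) := by
    refine tendsto_integral_of_dominated_convergence (fun x => max (-h 0 x) 0)
      (fun n => (hi n).neg_part.1) (hi 0).neg_part (fun n => ?_) ?_
    · filter_upwards [hanti] with x hx
      rw [Real.norm_of_nonneg (le_max_right _ _)]
      exact hx (Nat.zero_le n)
    · filter_upwards [hanti, ae_all_iff.2 fun k => measure_eq_zero_iff_ae_notMem.1 (hB k)]
        with x h1 h2
      rw [Metric.tendsto_atTop]
      intro ε hε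
      obtain ⟨k, hk⟩ := exists_nat_one_div_lt hε
      have h3 := h2 k
      simp only [not_forall, not_le] at h3
      obtain ⟨N, hN⟩ := h3
      refine ⟨N, fun n hn => ?_⟩
      rw [Real.dist_eq, sub_zero, abs_of_nonneg (le_max_right _ _)]
      refine (h1 hn).trans_lt (max_lt ?_ hε)
      linarith
  rw [integral_zero] at hneg
  have hg : ∀ n, ∃ g : X → ℝ, Integrable g m ∧ 0 ≤ᵐ[m] g ∧
      f' =ᵐ[m] fun x => h n x + (g x - transferOp m T g x) := by
    intro n
    induction n with
    | zero =>
      refine ⟨fun x => 0 * f' x, hf'.const_mul 0, Eventually.of_forall fun x => by simp, ?_⟩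
      filter_upwards [transferOp_const_mul hT hf' 0] with x hx
      rw [hx]; simp [h]
    | succ n ih =>
      obtain ⟨g, hgi, hg0, hge⟩ := ih
      refine ⟨fun x => g x + max (h n x) 0, hgi.add (hi n).pos_part, ?_, ?_⟩
      · filter_upwards [hg0] with x hx
        exact add_nonneg hx (le_max_right _ _)
      · filter_upwards [hge, transferOp_add hT hgi (hi n).pos_part] with x h1 h2
        rw [h1, h2, hs]
        rcases le_total (h n x) 0 with hx | hx
        · rw [max_eq_right hx, max_eq_left (neg_nonneg.2 hx)]; ring
        · rw [max_eq_left hx, max_eq_right (neg_nonpos.2 hx)]; ring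
  obtain ⟨n, hn⟩ := (hneg.eventually (gt_mem_nhds (half_pos hδ))).exists
  obtain ⟨g, hgi, hg0, hge⟩ := hg n
  refine ⟨g, h n, hgi, hi n, hg0, ?_, hff'.trans hge⟩
  have : ∫ x, |h n x| ∂m = ∫ x, max (h n x) 0 ∂m + ∫ x, max (-h n x) 0 ∂m := by
    rw [← integral_add (hi n).pos_part (hi n).neg_part]
    refine integral_congr_ae (Eventually.of_forall fun x => ?_)
    change |h n x| = max (h n x) 0 + max (-h n x) 0
    rcases le_total (h n x) 0 with hx | hx
    · rw [max_eq_right hx, max_eq_left (neg_nonneg.2 hx), abs_of_nonpos hx]; ring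
    · rw [max_eq_left hx, max_eq_right (neg_nonpos.2 hx), abs_of_nonneg hx]; ring
  rw [this, hpn n]
  linarith

/-- Split f into a small h and a coboundary. The maximal inequality for h - (ε/2)p controls h off a
set of small p-mass, and the coboundary sums stay below a fixed g. Strict positivity of p makes the
intersection of the exceptional sets null. -/
theorem eventually_transferSum_le (hcons : Conservative T m) (herg : Ergodic T m)
    (hf : Integrable f m) (hzero : ∫ x, f x ∂m = 0) {p : X → ℝ} (hp : Integrable p m)
    (hp0 : ∀ x, 0 < p x) {ε : ℝ} (hε : 0 < ε) :
    ∀ᵐ x ∂m, ∀ᶠ n in atTop, transferSum m T f n x ≤ ε * transferSum m T p n x := by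
  have hT := herg.toMeasurePreserving
  rcases eq_or_ne m 0 with rfl | hm
  · simp
  have hppos : 0 < ∫ x, p x ∂m := by
    rw [integral_pos_iff_support_of_nonneg (fun x => (hp0 x).le) hp]
    rw [Function.support_eq_univ fun x => (hp0 x).ne']
    exact (Measure.measure_univ_pos).2 hm
  have hex : ∀ k : ℕ, ∃ E, MeasurableSet E ∧ ∫ x in E, p x ∂m ≤ 1 / ((k : ℝ) + 1) ∧
      ∀ᵐ x ∂m, x ∉ E → ∀ᶠ n in atTop, transferSum m T f n x ≤ ε * transferSum m T p n x := by
    intro k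
    have hk : (0 : ℝ) < 1 / ((k : ℝ) + 1) := Nat.one_div_pos_of_nat
    obtain ⟨g, h, hg, hh, hg0, hhδ, hfe⟩ := exists_coboundary_approx hcons herg hf hzero
      (mul_pos (half_pos hε) hk)
    obtain ⟨E, hE, hSE, hEint⟩ := exists_setIntegral_nonneg_of_transferSum_pos hT
      (hh.sub (hp.const_mul (ε / 2)))
    refine ⟨E, hE, ?_, ?_⟩
    · simp only [Pi.sub_apply] at hEint
      rw [integral_sub hh.integrableOn (hp.const_mul _).integrableOn, integral_const_mul] at hEint
      have h1 : ∫ x in E, h x ∂m ≤ ∫ x, |h x| ∂m :=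
        (integral_mono hh.integrableOn hh.abs.integrableOn fun x => le_abs_self _).trans
          (setIntegral_le_integral hh.abs (Eventually.of_forall fun x => abs_nonneg _))
      refine le_of_mul_le_mul_left ?_ (half_pos hε)
      linarith
    · filter_upwards [hSE, transferSum_sub hT hh (hp.const_mul (ε / 2)),
        transferSum_const_mul hT hp (ε / 2), ae_all_iff.2 fun n => transferSum_congr (T := T) hfe n,
        transferSum_add hT hh (hg.sub (integrable_transferOp hg)), transferSum_coboundary hT hg,
        ae_all_iff.2 (iterate_transferOp_nonneg hT hg hg0),
        tendsto_transferSum_atTop hcons herg hp (Eventually.of_forall fun x => (hp0 x).le) hppos]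
        with x h1 h2 h3 h4 h5 h6 h7 h8 hxE
      -- Half of ε pays for h. The other half pays for g - T̂ⁿg ≤ g, because the sums of p diverge.
      filter_upwards [h8.eventually_ge_atTop (g x / (ε / 2))] with n hn
      have h9 : ¬ 0 < transferSum m T (fun x => h x - ε / 2 * p x) n x := fun hc => hxE (h1 n hc)
      rw [h2, h3] at h9
      have h5' := h5 n
      change transferSum m T (fun x => h x + (g x - transferOp m T g x)) n x
        = _ + transferSum m T (fun x => g x - transferOp m T g x) n x at h5'
      have h7' : 0 ≤ (transferOp m T)^[n] g x := h7 n
      rw [div_le_iff₀ (half_pos hε)] at hn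
      rw [h4, h5', h6]
      linarith
  choose E hE hEint hEae using hex
  have hnull : m (⋂ k, E k) = 0 := by
    by_contra hne
    have hmeas : MeasurableSet (⋂ k, E k) := MeasurableSet.iInter hE
    have hpos : 0 < ∫ x in ⋂ k, E k, p x ∂m := by
      rw [setIntegral_pos_iff_support_of_nonneg_ae (Eventually.of_forall fun x => (hp0 x).le)
        hp.integrableOn, Function.support_eq_univ fun x => (hp0 x).ne', Set.univ_inter]
      exact pos_iff_ne_zero.2 hne
    obtain ⟨k, hk⟩ := exists_nat_one_div_lt hpos
    have := setIntegral_mono_set hp.integrableOn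
      (Eventually.of_forall fun x => (hp0 x).le : 0 ≤ᵐ[m.restrict (E k)] p)
      (LE.le.eventuallyLE (Set.iInter_subset E k))
    linarith [hEint k]
  filter_upwards [measure_eq_zero_iff_ae_notMem.1 hnull, ae_all_iff.2 hEae] with x h1 h2
  simp only [Set.mem_iInter, not_forall] at h1
  obtain ⟨k, hk⟩ := h1
  exact h2 k hk

theorem tendsto_transferSum_div_of_pos (hcons : Conservative T m) (herg : Ergodic T m)
    (hf : Integrable f m) {p : X → ℝ} (hp : Integrable p m) (hp0 : ∀ x, 0 < p x) :
    ∀ᵐ x ∂m, Tendsto (fun n => transferSum m T f n x / transferSum m T p n x) atTop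
      (𝓝 ((∫ y, f y ∂m) / ∫ y, p y ∂m)) := by
  have hT := herg.toMeasurePreserving
  rcases eq_or_ne m 0 with rfl | hm
  · simp
  have hppos : 0 < ∫ x, p x ∂m := by
    rw [integral_pos_iff_support_of_nonneg (fun x => (hp0 x).le) hp]
    rw [Function.support_eq_univ fun x => (hp0 x).ne']
    exact (Measure.measure_univ_pos).2 hm
  set c := (∫ y, f y ∂m) / ∫ y, p y ∂m with hc
  have hcp : c * ∫ y, p y ∂m = ∫ y, f y ∂m := div_mul_cancel₀ _ hppos.ne'
  have h1 : ∫ x, (f x - c * p x) ∂m = 0 := by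
    rw [integral_sub hf (hp.const_mul _), integral_const_mul, hcp, sub_self]
  have h2 : ∫ x, (c * p x - f x) ∂m = 0 := by
    rw [integral_sub (hp.const_mul _) hf, integral_const_mul, hcp, sub_self]
  have h3 := ae_all_iff.2 fun k : ℕ => eventually_transferSum_le hcons herg
    (hf.sub (hp.const_mul c)) h1 hp hp0 (Nat.one_div_pos_of_nat (α := ℝ) (n := k))
  have h4 := ae_all_iff.2 fun k : ℕ => eventually_transferSum_le hcons herg
    ((hp.const_mul c).sub hf) h2 hp hp0 (Nat.one_div_pos_of_nat (α := ℝ) (n := k))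
  filter_upwards [h3, h4, transferSum_sub hT hf (hp.const_mul c),
    transferSum_sub hT (hp.const_mul c) hf, transferSum_const_mul hT hp c,
    tendsto_transferSum_atTop hcons herg hp (Eventually.of_forall fun x => (hp0 x).le) hppos]
    with x k3 k4 k5 k6 k7 k8
  rw [Metric.tendsto_atTop']
  intro ε hε
  obtain ⟨k, hk⟩ := exists_nat_one_div_lt hε
  obtain ⟨N, hN⟩ := eventually_atTop.1 ((k3 k).and ((k4 k).and (k8.eventually_gt_atTop 0)))
  refine ⟨N, fun n hn => ?_⟩
  obtain ⟨j1, j2, j3⟩ := hN n hn.le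
  have j1' : transferSum m T (fun x => f x - c * p x) n x ≤ _ := j1
  have j2' : transferSum m T (fun x => c * p x - f x) n x ≤ _ := j2
  rw [k5, k7] at j1'
  rw [k6, k7] at j2'
  refine lt_of_le_of_lt ?_ hk
  have e : transferSum m T f n x / transferSum m T p n x - c
      = (transferSum m T f n x - c * transferSum m T p n x) / transferSum m T p n x := by
    field_simp
  rw [Real.dist_eq, e, abs_div, abs_of_pos j3, div_le_iff₀ j3, abs_le]
  constructor <;> linarith

/-- Hurewicz's ratio ergodic theorem. -/
theorem tendsto_transferSum_div (hcons : Conservative T m) (herg : Ergodic T m)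
    (hf : Integrable f m) (hg : Integrable g m) (hg0 : ∫ x, g x ∂m ≠ 0) :
    ∀ᵐ x ∂m, Tendsto (fun n => transferSum m T f n x / transferSum m T g n x) atTop
      (𝓝 ((∫ y, f y ∂m) / ∫ y, g y ∂m)) := by
  rcases eq_or_ne m 0 with rfl | hm
  · simp
  -- Both sums are compared with those of one strictly positive integrable function.
  obtain ⟨w, hw0, hwm, hwlt⟩ := exists_pos_lintegral_lt_of_sigmaFinite m (one_ne_zero)
  set p : X → ℝ := fun x => w x with hpdef
  have hp0 : ∀ x, 0 < p x := fun x => NNReal.coe_pos.2 (hw0 x)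
  have hp : Integrable p m :=
    ⟨hwm.coe_nnreal_real.aestronglyMeasurable, by
      rw [hasFiniteIntegral_iff_ofReal (Eventually.of_forall fun x => (hp0 x).le)]
      simpa [hpdef] using hwlt.trans ENNReal.one_lt_top⟩
  have hppos : 0 < ∫ x, p x ∂m := by
    rw [integral_pos_iff_support_of_nonneg (fun x => (hp0 x).le) hp]
    rw [Function.support_eq_univ fun x => (hp0 x).ne']
    exact (Measure.measure_univ_pos).2 hm
  filter_upwards [tendsto_transferSum_div_of_pos hcons herg hf hp hp0,
    tendsto_transferSum_div_of_pos hcons herg hg hp hp0,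
    tendsto_transferSum_atTop hcons herg hp (Eventually.of_forall fun x => (hp0 x).le) hppos]
    with x h1 h2 h3
  have h4 := h1.div h2 (div_ne_zero hg0 hppos.ne')
  rw [div_div_div_cancel_right₀ hppos.ne'] at h4
  refine h4.congr' ?_
  filter_upwards [h3.eventually_gt_atTop 0] with n hn
  exact div_div_div_cancel_right₀ hn.ne' _ _

end Ratio

/-! ### Convergence in measure, limsups and essential suprema. -/

section InMeasure

variable {X : Type*} [MeasurableSpace X]

/-- For finite measures, convergence in measure means that every subsequence has an a.e. convergent
subsequence, a criterion that depends only on null sets. -/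
theorem TendstoInMeasure.of_absolutelyContinuous {ν ν' : Measure X} [IsFiniteMeasure ν]
    [IsFiniteMeasure ν'] (hac : ν' ≪ ν) {F : ℕ → X → ℝ} {g : X → ℝ}
    (hF : ∀ n, AEStronglyMeasurable (F n) ν) (h : TendstoInMeasure ν F atTop g) :
    TendstoInMeasure ν' F atTop g := by
  rw [exists_seq_tendstoInMeasure_atTop_iff fun n => (hF n).mono_ac hac]
  intro ns hns
  obtain ⟨ns', h1, h2⟩ := (exists_seq_tendstoInMeasure_atTop_iff hF).1 h ns hns
  exact ⟨ns', h1, hac.ae_le h2⟩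

/-- Since ν is finite, finitely many of the D j already cover all but an arbitrarily small part of
its mass. -/
theorem tendstoInMeasure_of_forall_restrict {ν : Measure X} [IsFiniteMeasure ν] {D : ℕ → Set X}
    (hD : ∀ j, MeasurableSet (D j)) (hcov : ∀ᵐ x ∂ν, ∃ j, x ∈ D j) {F : ℕ → X → ℝ} {g : X → ℝ}
    (h : ∀ j, TendstoInMeasure (ν.restrict (D j)) F atTop g) : TendstoInMeasure ν F atTop g := by
  intro ε hε
  rw [ENNReal.tendsto_nhds_zero]
  intro θ hθ
  let U : ℕ → Set X := fun J => (⋃ j ∈ Finset.range J, D j)ᶜ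
  have hU : ∀ J, MeasurableSet (U J) := fun J =>
    (Finset.measurableSet_biUnion _ fun j _ => hD j).compl
  have hanti : Antitone U := fun J K hJK x hx => by
    simp only [U, Set.mem_compl_iff, Set.mem_iUnion, not_exists, Finset.mem_range] at hx ⊢
    exact fun j hj => hx j (hj.trans_le hJK)
  have hlim := tendsto_measure_iInter_atTop (μ := ν) (fun J => (hU J).nullMeasurableSet) hanti
    ⟨0, measure_ne_top _ _⟩
  have hnull : ν (⋂ J, U J) = 0 := by
    rw [measure_eq_zero_iff_ae_notMem]
    filter_upwards [hcov] with x hx hxU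
    obtain ⟨j, hj⟩ := hx
    have := Set.mem_iInter.1 hxU (j + 1)
    simp only [U, Set.mem_compl_iff, Set.mem_iUnion, not_exists, Finset.mem_range] at this
    exact this j (Nat.lt_succ_self j) hj
  rw [hnull] at hlim
  have hθ2 : 0 < θ / 2 := ENNReal.half_pos hθ.ne'
  obtain ⟨J, hJ⟩ := ((ENNReal.tendsto_nhds_zero.1 hlim) _ hθ2).exists
  have hsum : Tendsto (fun n => ∑ j ∈ Finset.range J,
      ν.restrict (D j) {x | ε ≤ edist (F n x) (g x)}) atTop (𝓝 (∑ j ∈ Finset.range J, 0)) :=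
    tendsto_finsetSum _ fun j _ => h j ε hε
  rw [Finset.sum_const_zero] at hsum
  filter_upwards [(ENNReal.tendsto_nhds_zero.1 hsum) _ hθ2] with n hn
  have hsub : {x | ε ≤ edist (F n x) (g x)}
      ⊆ (⋃ j ∈ Finset.range J, {x | ε ≤ edist (F n x) (g x)} ∩ D j) ∪ U J := by
    intro x hx
    by_cases hxU : x ∈ U J
    · exact Or.inr hxU
    · left
      simp only [U, Set.mem_compl_iff, not_not, Set.mem_iUnion] at hxU ⊢
      obtain ⟨j, hj, hxj⟩ := hxU
      exact ⟨j, hj, hx, hxj⟩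
  calc ν {x | ε ≤ edist (F n x) (g x)}
      ≤ ν (⋃ j ∈ Finset.range J, {x | ε ≤ edist (F n x) (g x)} ∩ D j) + ν (U J) :=
        (measure_mono hsub).trans (measure_union_le _ _)
    _ ≤ θ / 2 + θ / 2 := by
        refine add_le_add ((measure_biUnion_finset_le _ _).trans ?_) hJ
        refine le_trans (le_of_eq (Finset.sum_congr rfl fun j _ => ?_)) hn
        rw [Measure.restrict_apply' (hD j)]
    _ = θ := ENNReal.add_halves θ

theorem limsup_coe_le_iff {u : ℕ → ℝ} {c : ℝ} :
    limsup (fun n => (u n : EReal)) atTop ≤ (c : EReal) ↔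
      ∀ ε > 0, ∀ᶠ n in atTop, u n ≤ c + ε := by
  constructor
  · intro h ε hε
    have h1 : limsup (fun n => (u n : EReal)) atTop < ((c + ε : ℝ) : EReal) :=
      h.trans_lt (EReal.coe_lt_coe_iff.2 (lt_add_of_pos_right c hε))
    filter_upwards [eventually_lt_of_limsup_lt h1] with n hn
    exact (EReal.coe_lt_coe_iff.1 hn).le
  · intro h
    refine le_of_forall_gt_imp_ge_of_dense fun b hb => ?_
    obtain ⟨r, hr1, hr2⟩ := EReal.lt_iff_exists_real_btwn.1 hb
    refine le_trans ?_ hr2.le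
    refine limsup_le_of_le (h := ?_)
    filter_upwards [h (r - c) (sub_pos.2 (EReal.coe_lt_coe_iff.1 hr1))] with n hn
    exact EReal.coe_le_coe_iff.2 (by linarith)

theorem ae_le_limsup_of_tendstoInMeasure {ν : Measure X} {F : ℕ → X → ℝ} {c : ℝ}
    (h : TendstoInMeasure ν F atTop fun _ => c) :
    ∀ᵐ x ∂ν, (c : EReal) ≤ limsup (fun n => (F n x : EReal)) atTop := by
  obtain ⟨ns, hns, hlim⟩ := h.exists_seq_tendsto_ae
  filter_upwards [hlim] with x hx
  have h1 : Tendsto (fun i => (F (ns i) x : EReal)) atTop (𝓝 (c : EReal)) :=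
    (continuous_coe_real_ereal.tendsto c).comp hx
  rw [← h1.limsup_eq]
  exact limsup_le_limsup_of_le (f := map ns atTop) (u := fun n => (F n x : EReal))
    hns.tendsto_atTop

theorem cond_absolutelyContinuous_cond {m : Measure X} {A B : Set X}
    (hAf : m A ≠ ⊤) (hBA : B ⊆ A) : ProbabilityTheory.cond m B ≪ ProbabilityTheory.cond m A := by
  unfold ProbabilityTheory.cond
  refine (Measure.smul_absolutelyContinuous).trans ?_
  refine (Measure.absolutelyContinuous_of_le (Measure.restrict_mono hBA le_rfl)).trans ?_
  exact Measure.absolutelyContinuous_smul (ENNReal.inv_ne_zero.2 hAf)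

/-- A lower bound for essential suprema along a sequence that converges in measure. -/
theorem eventually_lt_essSup {m : Measure X} {A : Set X} (hA0 : m A ≠ 0) (hAf : m A ≠ ⊤)
    {F : ℕ → X → ℝ} {c : ℝ}
    (h : TendstoInMeasure (ProbabilityTheory.cond m A) F atTop fun _ => c) {b : EReal}
    (hb : b < c) : ∀ᶠ n in atTop, b < essSup (fun x => (F n x : EReal)) (m.restrict A) := by
  obtain ⟨r, hr1, hr2⟩ := EReal.lt_iff_exists_real_btwn.1 hb
  have hr : 0 < c - r := sub_pos.2 (EReal.coe_lt_coe_iff.1 hr2)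
  have : IsProbabilityMeasure (ProbabilityTheory.cond m A) :=
    ProbabilityTheory.cond_isProbabilityMeasure_of_finite hA0 hAf
  have h1 := h (ENNReal.ofReal (c - r)) (ENNReal.ofReal_pos.2 hr)
  filter_upwards [h1.eventually (gt_mem_nhds one_pos)] with n hn
  by_contra! hle
  have hae : ∀ᵐ x ∂ProbabilityTheory.cond m A, F n x < r := by
    have : ∀ᵐ x ∂m.restrict A, F n x < r := by
      filter_upwards [ae_lt_of_essSup_lt (hle.trans_lt hr1)] with x hx
      exact EReal.coe_lt_coe_iff.1 hx
    exact Measure.smul_absolutelyContinuous.ae_le this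
  have huniv : ProbabilityTheory.cond m A {x | ENNReal.ofReal (c - r) ≤ edist (F n x) c} = 1 := by
    rw [← measure_univ (μ := ProbabilityTheory.cond m A)]
    refine measure_congr ?_
    filter_upwards [hae] with x hx
    refine propext ⟨fun _ => trivial, fun _ => ?_⟩
    change ENNReal.ofReal (c - r) ≤ edist (F n x) c
    rw [edist_dist, Real.dist_eq]
    refine ENNReal.ofReal_le_ofReal ?_
    rw [abs_sub_comm]
    exact le_trans (by linarith) (le_abs_self _)
  exact absurd hn (by rw [huniv]; exact lt_irrefl _)

end InMeasure

/-! ### Transfer of convergence and upper bounds between functions by the ratio theorem. -/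

section Comparison

variable {X : Type*} [MeasurableSpace X] {m : Measure X} {T : X → X} {f g : X → ℝ} {a : ℕ → ℝ}

theorem integrable_normSum (a : ℕ → ℝ) (hf : Integrable f m) (n : ℕ) :
    Integrable (normSum m T a f n) m :=
  (integrable_transferSum hf n).const_mul (1 / a n)

theorem measurable_normSum (a : ℕ → ℝ) (hf : Measurable f) (n : ℕ) :
    Measurable (normSum m T a f n) :=
  (measurable_transferSum hf n).const_mul (1 / a n)

variable [SigmaFinite m]

theorem tendstoInMeasure_normSum (hcons : Conservative T m) (herg : Ergodic T m)
    (hf : IsL1Pos m f) (hg : Integrable g m) {ν : Measure X} [IsFiniteMeasure ν] (hν : ν ≪ m)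
    (h : TendstoInMeasure ν (normSum m T a f) atTop fun _ => ∫ y, f y ∂m) :
    TendstoInMeasure ν (normSum m T a g) atTop fun _ => ∫ y, g y ∂m := by
  rw [exists_seq_tendstoInMeasure_atTop_iff fun n => (integrable_normSum a hg n).1.mono_ac hν]
  intro ns hns
  obtain ⟨ns', h1, h2⟩ := (exists_seq_tendstoInMeasure_atTop_iff
    fun n => (integrable_normSum a hf.1 n).1.mono_ac hν).1 h ns hns
  refine ⟨ns', h1, ?_⟩
  filter_upwards [h2, hν.ae_le (tendsto_transferSum_div hcons herg hg hf.1 hf.2.2.ne'),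
    hν.ae_le (tendsto_transferSum_atTop hcons herg hf.1 hf.2.1 hf.2.2)] with x k1 k2 k3
  have hsub : Tendsto (fun i => ns (ns' i)) atTop atTop :=
    hns.tendsto_atTop.comp h1.tendsto_atTop
  have k4 := (k2.comp hsub).mul k1
  rw [div_mul_cancel₀ _ hf.2.2.ne'] at k4
  refine k4.congr' ?_
  filter_upwards [(k3.comp hsub).eventually_gt_atTop 0] with i hi
  have hi' : transferSum m T f (ns (ns' i)) x ≠ 0 := ne_of_gt hi
  simp only [Function.comp_apply, normSum_eq]
  field_simp

/-- The implication stands inside the a.e. quantifier because in part (a) its premise is known only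
on A. -/
theorem ae_limsup_normSum_le (hcons : Conservative T m) (herg : Ergodic T m)
    (ha : ∀ n, 1 ≤ n → 0 < a n) (hf : IsL1Pos m f) (hg : IsL1Pos m g) :
    ∀ᵐ x ∂m, limsup (fun n => (normSum m T a f n x : EReal)) atTop ≤ ((∫ y, f y ∂m : ℝ) : EReal) →
      limsup (fun n => (normSum m T a g n x : EReal)) atTop ≤ ((∫ y, g y ∂m : ℝ) : EReal) := by
  filter_upwards [tendsto_transferSum_div hcons herg hg.1 hf.1 hf.2.2.ne',
    tendsto_transferSum_atTop hcons herg hf.1 hf.2.1 hf.2.2] with x k2 k3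
  rw [limsup_coe_le_iff, limsup_coe_le_iff]
  intro h ε hε
  set c := ∫ y, f y ∂m
  set r := (∫ y, g y ∂m) / c with hr
  have hrc : r * c = ∫ y, g y ∂m := div_mul_cancel₀ _ hf.2.2.ne'
  have hr0 : 0 < r := div_pos hg.2.2 hf.2.2
  have hδ : ∃ δ > 0, (r + δ) * (c + δ) < r * c + ε := by
    have h1 : Tendsto (fun δ : ℝ => (r + δ) * (c + δ)) (𝓝[>] 0) (𝓝 ((r + 0) * (c + 0))) := by
      refine Tendsto.mono_left ?_ nhdsWithin_le_nhds
      exact Continuous.tendsto (by fun_prop) 0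
    have h2 : (r + 0) * (c + 0) < r * c + ε := by simpa using hε
    obtain ⟨δ, h3, h4⟩ := ((h1.eventually (gt_mem_nhds h2)).and self_mem_nhdsWithin).exists
    exact ⟨δ, h4, h3⟩
  obtain ⟨δ, hδ0, hδ⟩ := hδ
  filter_upwards [h δ hδ0, k2.eventually (gt_mem_nhds (lt_add_of_pos_right r hδ0)),
    k3.eventually_gt_atTop 0, eventually_ge_atTop 1] with n h1 h2 h3 h4
  have e : normSum m T a g n x
      = transferSum m T g n x / transferSum m T f n x * normSum m T a f n x := by
    rw [normSum_eq, normSum_eq]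
    have := h3.ne'
    field_simp
  have h5 : 0 ≤ normSum m T a f n x := by
    rw [normSum_eq]; exact div_nonneg h3.le (ha n h4).le
  rw [e, ← hrc]
  refine le_trans ?_ hδ.le
  exact mul_le_mul h2.le h1 h5 (by linarith)

omit [SigmaFinite m] in
theorem isL1Pos_indicator {A : Set X} (hA : A ∈ finPosSets m) :
    IsL1Pos m (A.indicator fun _ => (1 : ℝ)) ∧
      ∫ y, A.indicator (fun _ => (1 : ℝ)) y ∂m = m.real A := by
  have h : ∫ y, A.indicator (fun _ => (1 : ℝ)) y ∂m = m.real A := by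
    rw [integral_indicator hA.1]; simp
  refine ⟨⟨(integrable_indicator_iff hA.1).2 (integrableOn_const hA.2.2.ne), ?_, ?_⟩, h⟩
  · exact Eventually.of_forall fun x => Set.indicator_nonneg (fun _ _ => zero_le_one) x
  · rw [h]; exact ENNReal.toReal_pos hA.2.1.ne' hA.2.2.ne

end Comparison

/-! ### Part (a): construction of limited sets. -/

section ExistenceOfLimitedSets

variable {X : Type*} [MeasurableSpace X] {m : Measure X} {T : X → X} {f : X → ℝ} {a : ℕ → ℝ}

/-- A one-sided form of Egorov's theorem. -/
theorem exists_subset_forall_le {B : Set X} (hB : MeasurableSet B) (hBf : m B ≠ ⊤)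
    {F : ℕ → X → ℝ} (hF : ∀ n, Measurable (F n)) {b : ℝ}
    (h : ∀ᵐ x ∂m, x ∈ B → ∀ᶠ n in atTop, F n x ≤ b) {δ : ℝ} (hδ : 0 < δ) :
    ∃ B' ⊆ B, MeasurableSet B' ∧ m.real B - δ ≤ m.real B' ∧ ∃ N, ∀ n ≥ N, ∀ x ∈ B', F n x ≤ b := by
  let G : ℕ → Set X := fun N => B ∩ {x | ∀ n ≥ N, F n x ≤ b}
  have hG : ∀ N, MeasurableSet (G N) := fun N => by
    refine hB.inter ?_
    simp only [Set.ofPred_forall]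
    exact MeasurableSet.iInter fun n => MeasurableSet.iInter fun _ =>
      measurableSet_le (hF n) measurable_const
  have hmono : Monotone G := fun N K hNK x hx => ⟨hx.1, fun n hn => hx.2 n (le_trans hNK hn)⟩
  have hUn : m (⋃ N, G N) = m B := by
    refine measure_congr ?_
    filter_upwards [h] with x hx
    refine propext ⟨fun hxG => ?_, fun hxB => ?_⟩
    · obtain ⟨N, hN⟩ := Set.mem_iUnion.1 hxG
      exact hN.1
    · obtain ⟨N, hN⟩ := eventually_atTop.1 (hx hxB)
      exact Set.mem_iUnion.2 ⟨N, hxB, hN⟩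
  have hlim : Tendsto (fun N => m.real (G N)) atTop (𝓝 (m.real B)) := by
    have := tendsto_measure_iUnion_atTop (μ := m) hmono
    rw [hUn] at this
    exact (ENNReal.tendsto_toReal hBf).comp this
  obtain ⟨N, hN⟩ := (hlim.eventually (lt_mem_nhds (sub_lt_self (m.real B) hδ))).exists
  exact ⟨G N, Set.inter_subset_left, hG N, hN.le, N, fun n hn x hx => hx.2 n hn⟩

theorem exists_isLimitedSetWith [SigmaFinite m] (hcons : Conservative T m) (herg : Ergodic T m)
    {A : Set X} (hA : A ∈ finPosSets m) (hf : IsL1Pos m f) (ha : ∀ n, 1 ≤ n → 0 < a n)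
    (hmeas : TendstoInMeasure (ProbabilityTheory.cond m A) (normSum m T a f) atTop
      fun _ => ∫ y, f y ∂m)
    (hsup : ∀ᵐ x ∂m.restrict A, limsup (fun n => (normSum m T a f n x : EReal)) atTop
      = ((∫ y, f y ∂m : ℝ) : EReal)) {η : ℝ} (hη : 0 < η) :
    ∃ A' ⊆ A, IsLimitedSetWith m T A' a ∧ m.real A - η ≤ m.real A' := by
  have hT := herg.toMeasurePreserving
  have hA0 : 0 < m.real A := ENNReal.toReal_pos hA.2.1.ne' hA.2.2.ne
  -- The cap m(A)/2 keeps the measure of A' positive even when η is large.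
  set θ := min η (m.real A / 2) with hθdef
  have hθ : 0 < θ := lt_min hη (half_pos hA0)
  have hind : ∀ B : Set X, MeasurableSet B → Measurable (B.indicator fun _ => (1 : ℝ)) :=
    fun B hB => measurable_const.indicator hB
  -- Step k may lose θ/2^(k+1), for a total loss of at most θ. Positivity of m(B) is not carried
  -- along, so null B is treated separately.
  have hstep : ∀ (k : ℕ) (B : {B : Set X // MeasurableSet B ∧ B ⊆ A}),
      ∃ B' : {B : Set X // MeasurableSet B ∧ B ⊆ A}, B'.1 ⊆ B.1 ∧
        m.real B.1 - θ / 2 / 2 ^ k ≤ m.real B'.1 ∧ ∃ N, ∀ n ≥ N, ∀ x ∈ B'.1,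
          normSum m T a (B.1.indicator fun _ => (1 : ℝ)) n x ≤ m.real B.1 + 1 / ((k : ℝ) + 1) := by
    intro k B
    have hδ : 0 < θ / 2 / 2 ^ k := by positivity
    have hBf : m B.1 < ⊤ := (measure_mono B.2.2).trans_lt hA.2.2
    have hub : ∀ᵐ x ∂m, x ∈ B.1 → ∀ᶠ n in atTop,
        normSum m T a (B.1.indicator fun _ => (1 : ℝ)) n x ≤ m.real B.1 + 1 / ((k : ℝ) + 1) := by
      rcases eq_or_ne (m B.1) 0 with h0 | h0
      · filter_upwards [measure_eq_zero_iff_ae_notMem.1 h0] with x hx hxB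
        exact absurd hxB hx
      · obtain ⟨hBL, hBi⟩ := isL1Pos_indicator (m := m) ⟨B.2.1, pos_iff_ne_zero.2 h0, hBf⟩
        filter_upwards [ae_limsup_normSum_le hcons herg ha hf hBL,
          (ae_restrict_iff' hA.1).1 hsup] with x h1 h2 hxB
        rw [hBi] at h1
        exact limsup_coe_le_iff.1 (h1 (h2 (B.2.2 hxB)).le) _ Nat.one_div_pos_of_nat
    obtain ⟨B', h1, h2, h3, h4⟩ := exists_subset_forall_le B.2.1 hBf.ne
      (fun n => measurable_normSum a (hind _ B.2.1) n) hub hδ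
    exact ⟨⟨B', h2, h1.trans B.2.2⟩, h1, h3, h4⟩
  choose nxt hnsub hnmeas hnle using hstep
  let s : ℕ → {B : Set X // MeasurableSet B ∧ B ⊆ A} := fun k =>
    Nat.rec ⟨A, hA.1, subset_rfl⟩ (fun k B => nxt k B) k
  have hss : ∀ k, s (k + 1) = nxt k (s k) := fun _ => rfl
  have hanti : Antitone fun k => (s k).1 := antitone_nat_of_succ_le fun k => by
    rw [hss]; exact hnsub k (s k)
  have hlow : ∀ k, m.real A - θ * (1 - 1 / 2 ^ k) ≤ m.real (s k).1 := by
    intro k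
    induction k with
    | zero => simp [s]
    | succ k ih =>
      have h1 := hnmeas k (s k)
      rw [← hss] at h1
      refine le_trans (le_of_eq ?_) ((sub_le_sub_right ih _).trans h1)
      rw [pow_succ]
      field_simp
      ring
  set A' := ⋂ k, (s k).1 with hA'def
  have hA'm : MeasurableSet A' := MeasurableSet.iInter fun k => (s k).2.1
  have hA'A : A' ⊆ A := Set.iInter_subset _ 0
  have hlim : Tendsto (fun k => m.real (s k).1) atTop (𝓝 (m.real A')) := by
    have hA'f : m A' ≠ ⊤ := ((measure_mono hA'A).trans_lt hA.2.2).ne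
    exact (ENNReal.tendsto_toReal hA'f).comp (tendsto_measure_iInter_atTop
      (fun k => (s k).2.1.nullMeasurableSet) hanti ⟨0, hA.2.2.ne⟩)
  have hA'θ : m.real A - θ ≤ m.real A' := by
    refine ge_of_tendsto' hlim fun k => le_trans ?_ (hlow k)
    have : (0 : ℝ) < 1 / 2 ^ k := by positivity
    nlinarith
  have hA'0 : 0 < m.real A' := by
    have := min_le_right η (m.real A / 2)
    linarith
  have hA'F : A' ∈ finPosSets m :=
    ⟨hA'm, (ENNReal.toReal_pos_iff.1 hA'0).1, (ENNReal.toReal_pos_iff.1 hA'0).2⟩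
  obtain ⟨hL, hLi⟩ := isL1Pos_indicator hA'F
  have hmeas' : TendstoInMeasure (ProbabilityTheory.cond m A')
      (normSum m T a (A'.indicator fun _ => 1)) atTop (fun _ => m.real A') := by
    have i1 : IsProbabilityMeasure (ProbabilityTheory.cond m A) :=
      ProbabilityTheory.cond_isProbabilityMeasure_of_finite hA.2.1.ne' hA.2.2.ne
    have i2 : IsProbabilityMeasure (ProbabilityTheory.cond m A') :=
      ProbabilityTheory.cond_isProbabilityMeasure_of_finite hA'F.2.1.ne' hA'F.2.2.ne
    rw [← hLi]
    refine tendstoInMeasure_normSum hcons herg hf hL.1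
      ProbabilityTheory.cond_absolutelyContinuous ?_
    exact TendstoInMeasure.of_absolutelyContinuous
      (cond_absolutelyContinuous_cond hA.2.2.ne hA'A)
      (fun n => (integrable_normSum a hf.1 n).1.mono_ac
        ProbabilityTheory.cond_absolutelyContinuous) hmeas
  refine ⟨A', hA'A, ⟨hA'F, ha, hmeas', ?_⟩, by linarith [min_le_left η (m.real A / 2)]⟩
  rw [tendsto_order]
  refine ⟨fun b hb => eventually_lt_essSup hA'F.2.1.ne' hA'F.2.2.ne hmeas' hb, fun b hb => ?_⟩
  obtain ⟨r, hr1, hr2⟩ := EReal.lt_iff_exists_real_btwn.1 hb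
  have hr : m.real A' < r := EReal.coe_lt_coe_iff.1 hr1
  have hk : ∀ᶠ k : ℕ in atTop, m.real (s k).1 + 1 / ((k : ℝ) + 1) < r := by
    have := hlim.add (tendsto_one_div_add_atTop_nhds_zero_nat (𝕜 := ℝ))
    rw [add_zero] at this
    exact this.eventually (gt_mem_nhds hr)
  obtain ⟨k, hk⟩ := hk.exists
  obtain ⟨N, hN⟩ := hnle k (s k)
  filter_upwards [eventually_ge_atTop N, eventually_ge_atTop 1] with n hn hn1
  refine lt_of_le_of_lt ?_ hr2
  refine essSup_le_of_ae_le _ ?_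
  rw [EventuallyLE, ae_restrict_iff' hA'm]
  have hsk : Integrable ((s k).1.indicator fun _ => (1 : ℝ)) m :=
    (integrable_indicator_iff (s k).2.1).2
      (integrableOn_const ((measure_mono (s k).2.2).trans_lt hA.2.2).ne)
  -- A' lies in both s k and s (k+1): the first inclusion compares the sums, the second supplies the
  -- uniform bound.
  filter_upwards [transferSum_mono hT hL.1 hsk (Eventually.of_forall fun x =>
    Set.indicator_le_indicator_of_subset (Set.iInter_subset _ k) (fun _ => zero_le_one) x)]
    with x hx hxA'
  have h1 := hN n hn x (Set.mem_iInter.1 hxA' (k + 1))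
  refine EReal.coe_le_coe_iff.2 (le_trans ?_ (h1.trans hk.le))
  rw [normSum_eq, normSum_eq]
  exact div_le_div_of_nonneg_right (hx n) (ha n hn1).le

end ExistenceOfLimitedSets

/-! ### Part (b): from a limited set to weak pointwise dual ergodicity. -/

section LimitedSets

variable {X : Type*} [MeasurableSpace X] {m : Measure X} {T : X → X} {a : ℕ → ℝ} {A : Set X}

variable [SigmaFinite m]

/-- The maximum principle: an upper bound on `A` for the sums `∑_{k < n} T̂ᵏ 1_A` is an upper bound
everywhere. -/
theorem transferSum_indicator_le (hT : MeasurePreserving T m m) (hA : A ∈ finPosSets m) {M : ℝ}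
    (hM : 0 ≤ M) (n : ℕ)
    (h : ∀ᵐ x ∂m, x ∈ A → transferSum m T (A.indicator fun _ => (1 : ℝ)) n x ≤ M) :
    ∀ᵐ x ∂m, transferSum m T (A.indicator fun _ => (1 : ℝ)) n x ≤ M := by
  obtain ⟨⟨hi, h0, -⟩, -⟩ := isL1Pos_indicator hA
  induction n with
  | zero => exact Eventually.of_forall fun x => by simpa [transferSum] using hM
  | succ n ih =>
    have h1 : ∀ᵐ x ∂m, x ∈ A → transferSum m T (A.indicator fun _ => (1 : ℝ)) n x ≤ M := by
      filter_upwards [h, monotone_transferSum hT hi h0] with x hx hmono hxA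
      exact (hmono (Nat.le_succ n)).trans (hx hxA)
    -- Off A the sum of length n+1 is T̂ of the sum of length n, and T̂ preserves upper bounds by
    -- constants.
    filter_upwards [h, transferOp_le_const hT (integrable_transferSum hi n) (ih h1),
      transferSum_succ hT hi n] with x k1 k2 k3
    by_cases hxA : x ∈ A
    · exact k1 hxA
    · rw [k3, Set.indicator_of_notMem hxA, zero_add]
      exact k2

theorem eventually_ae_normSum_le (hT : MeasurePreserving T m m) (h : IsLimitedSetWith m T A a)
    {ε : ℝ} (hε : 0 < ε) :
    ∀ᶠ n in atTop, ∀ᵐ x ∂m, normSum m T a (A.indicator fun _ => 1) n x ≤ m.real A + ε := by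
  obtain ⟨hA, ha, -, hsup⟩ := h
  have h1 : (m.real A : EReal) < ((m.real A + ε : ℝ) : EReal) :=
    EReal.coe_lt_coe_iff.2 (lt_add_of_pos_right _ hε)
  filter_upwards [hsup.eventually (gt_mem_nhds h1), eventually_ge_atTop 1] with n hn hn1
  have h2 := (ae_restrict_iff' hA.1).1 (ae_lt_of_essSup_lt hn)
  have h3 := transferSum_indicator_le hT hA (M := (m.real A + ε) * a n)
    (mul_nonneg (add_nonneg measureReal_nonneg hε.le) (ha n hn1).le) n (by
      filter_upwards [h2] with x hx hxA
      have := EReal.coe_lt_coe_iff.1 (hx hxA)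
      rw [normSum_eq, div_lt_iff₀ (ha n hn1)] at this
      exact this.le)
  filter_upwards [h3] with x hx
  rwa [normSum_eq, div_le_iff₀ (ha n hn1)]

omit [SigmaFinite m] in
theorem IsLimitedSetWith.tendstoInMeasure_restrict (h : IsLimitedSetWith m T A a) :
    TendstoInMeasure (m.restrict A) (normSum m T a (A.indicator fun _ => 1)) atTop
      (fun _ => m.real A) := by
  obtain ⟨hA, -, hmeas, -⟩ := h
  have : IsProbabilityMeasure (ProbabilityTheory.cond m A) :=
    ProbabilityTheory.cond_isProbabilityMeasure_of_finite hA.2.1.ne' hA.2.2.ne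
  have : IsFiniteMeasure (m.restrict A) := ⟨by simpa using hA.2.2⟩
  refine TendstoInMeasure.of_absolutelyContinuous (ν := ProbabilityTheory.cond m A) ?_
    (fun n => (integrable_normSum a (isL1Pos_indicator hA).1.1 n).1.mono_ac
        ProbabilityTheory.cond_absolutelyContinuous) hmeas
  exact Measure.absolutelyContinuous_smul (ENNReal.inv_ne_zero.2 hA.2.2.ne)

/-- At a single point where, along a subsequence, the normalized sums tend to m(A) while the sums
themselves diverge, a_n must diverge. -/
theorem IsLimitedSetWith.tendsto_inv (hcons : Conservative T m) (herg : Ergodic T m)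
    (h : IsLimitedSetWith m T A a) : Tendsto (fun n => 1 / a n) atTop (𝓝 0) := by
  have hA := h.1
  obtain ⟨hL, -⟩ := isL1Pos_indicator hA
  refine tendsto_of_subseq_tendsto fun ns hns => ?_
  obtain ⟨ms, hms, hae⟩ := (h.tendstoInMeasure_restrict.comp hns).exists_seq_tendsto_ae
  refine ⟨ms, ?_⟩
  have hne : (ae (m.restrict A)).NeBot := by
    rw [ae_neBot, Ne, Measure.restrict_eq_zero]
    exact hA.2.1.ne'
  obtain ⟨x, hx1, hx2⟩ := (hae.and (ae_restrict_of_ae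
    (tendsto_transferSum_atTop hcons herg hL.1 hL.2.1 hL.2.2))).exists
  have h3 := hx2.comp (hns.comp hms.tendsto_atTop)
  refine (hx1.div_atTop h3).congr' ?_
  filter_upwards [h3.eventually_gt_atTop 0] with i hi
  have hi' : transferSum m T (A.indicator fun _ => (1 : ℝ)) (ns (ms i)) x ≠ 0 := ne_of_gt hi
  simp only [Function.comp_apply, normSum_eq]
  field_simp

theorem IsLimitedSetWith.tendsto_setIntegral (herg : Ergodic T m)
    (h : IsLimitedSetWith m T A a) :
    Tendsto (fun n => ∫ x in A, normSum m T a (A.indicator fun _ => 1) n x ∂m) atTop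
      (𝓝 (m.real A * m.real A)) := by
  have hT := herg.toMeasurePreserving
  have hA := h.1
  obtain ⟨hL, -⟩ := isL1Pos_indicator hA
  have : IsFiniteMeasure (m.restrict A) := ⟨by simpa using hA.2.2⟩
  have hc : ∫ x in A, m.real A ∂m = m.real A * m.real A := by simp
  rw [← hc]
  refine tendsto_of_subseq_tendsto fun ns hns => ?_
  obtain ⟨ms, hms, hae⟩ := (h.tendstoInMeasure_restrict.comp hns).exists_seq_tendsto_ae
  refine ⟨ms, ?_⟩
  have hsub := hns.comp hms.tendsto_atTop
  refine tendsto_integral_filter_of_dominated_convergence (fun _ => m.real A + 1)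
    (Eventually.of_forall fun i => (integrable_normSum a hL.1 _).1.restrict) ?_
    (integrable_const _) hae
  filter_upwards [hsub.eventually (eventually_ae_normSum_le hT h one_pos),
    hsub.eventually_ge_atTop 1] with i hi hi1
  filter_upwards [ae_restrict_of_ae hi, ae_restrict_of_ae (transferSum_nonneg hT hL.1 hL.2.1)]
    with x h1 h2
  refine (Real.norm_of_nonneg ?_).trans_le h1
  rw [normSum_eq]
  exact div_nonneg (h2 _) (h.2.1 _ hi1).le

/-- By duality the integral of S_n 1_A over T⁻¹C is that of T̂ S_n 1_A over C, and T̂ S_n 1_A - S_n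
1_A = T̂ⁿ1_A - 1_A is bounded by 1 in absolute value. -/
theorem IsLimitedSetWith.tendsto_setIntegral_preimage (hcons : Conservative T m)
    (herg : Ergodic T m) (h : IsLimitedSetWith m T A a) {C : Set X} (hC : MeasurableSet C)
    (hCf : m C ≠ ⊤)
    (hlim : Tendsto (fun n => ∫ x in C, normSum m T a (A.indicator fun _ => 1) n x ∂m) atTop
      (𝓝 (m.real A * m.real C))) :
    Tendsto (fun n => ∫ x in T ⁻¹' C, normSum m T a (A.indicator fun _ => 1) n x ∂m) atTop
      (𝓝 (m.real A * m.real C)) := by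
  have hT := herg.toMeasurePreserving
  have hA := h.1
  obtain ⟨hL, -⟩ := isL1Pos_indicator hA
  set u : X → ℝ := A.indicator fun _ => (1 : ℝ) with hu
  have hint : ∀ (n : ℕ) (B : Set X), ∫ x in B, normSum m T a u n x ∂m
      = 1 / a n * ∫ x in B, transferSum m T u n x ∂m := fun n B =>
    integral_const_mul (1 / a n) (transferSum m T u n)
  have hdiff : ∀ n, ∫ x in T ⁻¹' C, transferSum m T u n x ∂m
      = ∫ x in C, transferSum m T u n x ∂m
        + (∫ x in C, (transferOp m T)^[n] u x ∂m - ∫ x in C, u x ∂m) := by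
    intro n
    rw [← setIntegral_transferOp hT.quasiMeasurePreserving (integrable_transferSum hL.1 n) hC,
      ← integral_sub (integrable_iterate_transferOp hL.1 n).integrableOn hL.1.integrableOn,
      ← integral_add (g := fun x => (transferOp m T)^[n] u x - u x)
        (integrable_transferSum hL.1 n).integrableOn
        ((integrable_iterate_transferOp hL.1 n).integrableOn.sub hL.1.integrableOn)]
    refine integral_congr_ae (ae_restrict_of_ae ?_)
    filter_upwards [transferSum_succ hT hL.1 n] with x hx
    have := transferSum_succ_last m T u n x
    linarith
  have hu1 : ∀ᵐ x ∂m, u x ≤ 1 := Eventually.of_forall fun x => by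
    rw [hu]; exact Set.indicator_apply_le' (fun _ => le_rfl) (fun _ => zero_le_one)
  have hbd : ∀ n, ∫ x in C, (transferOp m T)^[n] u x ∂m ∈ Set.Icc 0 (m.real C) := by
    intro n
    refine ⟨setIntegral_nonneg_of_ae (iterate_transferOp_nonneg hT hL.1 hL.2.1 n), ?_⟩
    have e : ∫ x in C, (1 : ℝ) ∂m = m.real C := by simp
    rw [← e]
    exact setIntegral_mono_ae (integrable_iterate_transferOp hL.1 n).integrableOn
      (integrableOn_const hCf) (iterate_transferOp_le_const hT hL.1 hu1 n)
  have hsmall : Tendsto (fun n => 1 / a n *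
      (∫ x in C, (transferOp m T)^[n] u x ∂m - ∫ x in C, u x ∂m)) atTop (𝓝 0) := by
    refine (h.tendsto_inv hcons herg).zero_mul_isBoundedUnder_le ?_
    refine isBoundedUnder_of ⟨m.real C, fun n => ?_⟩
    have h1 := hbd n
    have h2 : ∫ x in C, u x ∂m ∈ Set.Icc 0 (m.real C) := hbd 0
    rw [Function.comp_apply, Real.norm_eq_abs, abs_le]
    constructor <;> linarith [h1.1, h1.2, h2.1, h2.2]
  have := hlim.add hsmall
  rw [add_zero] at this
  refine this.congr fun n => ?_
  rw [hint, hint, hdiff]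
  ring

theorem IsLimitedSetWith.tendstoInMeasure_restrict_of_tendsto_setIntegral
    (hT : MeasurePreserving T m m) (h : IsLimitedSetWith m T A a) {C : Set X} (hCf : m C ≠ ⊤)
    (hlim : Tendsto (fun n => ∫ x in C, normSum m T a (A.indicator fun _ => 1) n x ∂m) atTop
      (𝓝 (m.real A * m.real C))) :
    TendstoInMeasure (m.restrict C) (normSum m T a (A.indicator fun _ => 1)) atTop
      (fun _ => m.real A) := by
  have hA := h.1
  obtain ⟨hL, -⟩ := isL1Pos_indicator hA
  have : IsFiniteMeasure (m.restrict C) := ⟨by simpa using hCf.lt_top⟩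
  set F := normSum m T a (A.indicator fun _ => (1 : ℝ)) with hF
  set c := m.real A with hc
  have hFi : ∀ n, Integrable (F n) (m.restrict C) :=
    fun n => (integrable_normSum a hL.1 n).integrableOn
  have hdi : ∀ n, Integrable (fun x => F n x - c) (m.restrict C) :=
    fun n => (hFi n).sub (integrable_const c)
  have hL1 : Tendsto (fun n => ∫ x in C, ‖F n x - c‖ ∂m) atTop (𝓝 0) := by
    rw [Metric.tendsto_atTop']
    intro θ hθ
    have hC0 : 0 ≤ m.real C := measureReal_nonneg
    -- The bound F n ≤ c + ε yields |F n - c| ≤ c + 2ε - F n, whose integral over C tends to 2ε m(C)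
    -- < θ.
    set ε := θ / (2 * m.real C + 1) / 2 with hεdef
    have hε : 0 < ε := by positivity
    have hεθ : 2 * ε * m.real C < θ := by
      have : θ = 2 * ε * (2 * m.real C + 1) := by rw [hεdef]; field_simp
      nlinarith
    have h1 : Tendsto (fun n => (c + 2 * ε) * m.real C - ∫ x in C, F n x ∂m) atTop
        (𝓝 ((c + 2 * ε) * m.real C - c * m.real C)) := hlim.const_sub _
    have h2 : (c + 2 * ε) * m.real C - c * m.real C < θ := by linarith
    obtain ⟨N, hN⟩ := eventually_atTop.1
      ((h1.eventually (gt_mem_nhds h2)).and (eventually_ae_normSum_le hT h hε))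
    refine ⟨N, fun n hn => ?_⟩
    obtain ⟨h3, h4⟩ := hN n hn.le
    rw [Real.dist_eq, sub_zero, abs_of_nonneg (integral_nonneg fun x => norm_nonneg _)]
    refine lt_of_le_of_lt ?_ h3
    have e : (c + 2 * ε) * m.real C - ∫ x in C, F n x ∂m
        = ∫ x in C, (c + 2 * ε - F n x) ∂m := by
      rw [integral_sub (integrable_const _) (hFi n)]
      simp [mul_comm]
    rw [e]
    refine integral_mono_ae (hdi n).norm ((integrable_const _).sub (hFi n)) ?_
    filter_upwards [ae_restrict_of_ae h4] with x hx
    rw [Real.norm_eq_abs, abs_le]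
    constructor <;> linarith
  refine tendstoInMeasure_of_tendsto_eLpNorm (p := 1) one_ne_zero (fun n => (hFi n).1)
    aestronglyMeasurable_const ?_
  have h5 : ∀ n, eLpNorm (F n - fun _ => c) 1 (m.restrict C)
      = ENNReal.ofReal (∫ x in C, ‖F n x - c‖ ∂m) := fun n => by
    rw [eLpNorm_one_eq_lintegral_enorm, ofReal_integral_norm_eq_lintegral_enorm (hdi n)]
    rfl
  simp_rw [h5]
  rw [← ENNReal.ofReal_zero]
  exact ENNReal.tendsto_ofReal hL1

theorem IsLimitedSetWith.tendstoInMeasureSigma (hcons : Conservative T m) (herg : Ergodic T m)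
    (h : IsLimitedSetWith m T A a) :
    TendstoInMeasureSigma m (normSum m T a (A.indicator fun _ => 1)) (fun _ => m.real A) := by
  intro ν _ hν
  have hT := herg.toMeasurePreserving
  have hA := h.1
  obtain ⟨hL, -⟩ := isL1Pos_indicator hA
  have hD : ∀ j, MeasurableSet (T^[j] ⁻¹' A) := fun j => hT.measurable.iterate j hA.1
  have hDm : ∀ j, m (T^[j] ⁻¹' A) = m A := fun j =>
    (hT.iterate j).measure_preimage hA.1.nullMeasurableSet
  have hlim : ∀ j, Tendsto (fun n => ∫ x in T^[j] ⁻¹' A,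
      normSum m T a (A.indicator fun _ => 1) n x ∂m) atTop
      (𝓝 (m.real A * m.real (T^[j] ⁻¹' A))) := by
    intro j
    induction j with
    | zero => exact h.tendsto_setIntegral herg
    | succ j ih =>
      have e : m.real (T^[j + 1] ⁻¹' A) = m.real (T^[j] ⁻¹' A) := by
        rw [measureReal_def, measureReal_def, hDm, hDm]
      rw [e, Function.iterate_succ, Set.preimage_comp]
      exact h.tendsto_setIntegral_preimage hcons herg (hD j) (by rw [hDm]; exact hA.2.2.ne) ih
  refine tendstoInMeasure_of_forall_restrict hD ?_ fun j => ?_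
  · exact hν.ae_le ((ae_frequently_iterate_mem hcons herg hA.1 hA.2.1.ne').mono
      fun x hx => hx.exists)
  · have : IsFiniteMeasure (m.restrict (T^[j] ⁻¹' A)) := ⟨by
      rw [Measure.restrict_apply_univ, hDm]; exact hA.2.2⟩
    exact TendstoInMeasure.of_absolutelyContinuous (hν.restrict _)
      (fun n => (integrable_normSum a hL.1 n).1.restrict)
      (h.tendstoInMeasure_restrict_of_tendsto_setIntegral hT
        (by rw [hDm]; exact hA.2.2.ne) (hlim j))

theorem IsLimitedSetWith.weaklyPointwiseDualErgodic (hcons : Conservative T m)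
    (herg : Ergodic T m) (h : IsLimitedSetWith m T A a) : WeaklyPointwiseDualErgodic m T := by
  have hT := herg.toMeasurePreserving
  obtain ⟨hL, hLi⟩ := isL1Pos_indicator h.1
  have hsigma : ∀ f : X → ℝ, IsL1Pos m f →
      TendstoInMeasureSigma m (normSum m T a f) (fun _ => ∫ y, f y ∂m) := by
    intro f hf ν hν hνm
    refine tendstoInMeasure_normSum hcons herg hL hf.1 hνm ?_
    rw [hLi]
    exact h.tendstoInMeasureSigma hcons herg ν hν hνm
  have hup : ∀ᵐ x ∂m, limsup
      (fun n => (normSum m T a (A.indicator fun _ => (1 : ℝ)) n x : EReal)) atTop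
        ≤ (m.real A : EReal) := by
    have h1 : ∀ k : ℕ, ∀ᵐ x ∂m, ∀ᶠ n in atTop,
        normSum m T a (A.indicator fun _ => (1 : ℝ)) n x ≤ m.real A + 1 / ((k : ℝ) + 1) := by
      intro k
      obtain ⟨N, hN⟩ := eventually_atTop.1
        (eventually_ae_normSum_le hT h (Nat.one_div_pos_of_nat (α := ℝ) (n := k)))
      have h2 : ∀ᵐ x ∂m, ∀ n, N ≤ n →
          normSum m T a (A.indicator fun _ => (1 : ℝ)) n x ≤ m.real A + 1 / ((k : ℝ) + 1) :=
        ae_all_iff.2 fun n => by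
          by_cases hn : N ≤ n
          · exact (hN n hn).mono fun x hx _ => hx
          · exact Eventually.of_forall fun x hx => absurd hx hn
      exact h2.mono fun x hx => eventually_atTop.2 ⟨N, hx⟩
    filter_upwards [ae_all_iff.2 h1] with x hx
    rw [limsup_coe_le_iff]
    intro ε hε
    obtain ⟨k, hk⟩ := exists_nat_one_div_lt hε
    filter_upwards [hx k] with n hn
    linarith
  refine ⟨a, h.2.1, hsigma, fun f hf => ?_⟩
  -- `m.toFinite` is a finite measure with the same null sets as m.
  have hlow := (absolutelyContinuous_toFinite m).ae_le
    (ae_le_limsup_of_tendstoInMeasure (hsigma f hf m.toFinite inferInstance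
      (toFinite_absolutelyContinuous m)))
  filter_upwards [hup, hlow, ae_limsup_normSum_le hcons herg h.2.1 hL hf] with x h1 h2 h3
  rw [hLi] at h3
  exact le_antisymm (h3 h1) h2

end LimitedSets

end WeakPDE

end

theorem mainTheorem7 {X : Type*} [MeasurableSpace X] (m : Measure X) [SigmaFinite m]
    (T : X → X) (hcons : Conservative T m) (herg : Ergodic T m) :
    (∀ (A : Set X) (f : X → ℝ) (a : ℕ → ℝ),
      A ∈ WeakPDE.finPosSets m → WeakPDE.IsL1Pos m f → (∀ n, 1 ≤ n → 0 < a n) →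
      TendstoInMeasure (ProbabilityTheory.cond m A) (WeakPDE.normSum m T a f) atTop
        (fun _ => ∫ y, f y ∂m) →
      (∀ᵐ x ∂(m.restrict A), limsup (fun n => (WeakPDE.normSum m T a f n x : EReal)) atTop
        = ((∫ y, f y ∂m : ℝ) : EReal)) →
      ∀ η : ℝ, 0 < η → ∃ A' : Set X, A' ⊆ A ∧ WeakPDE.IsLimitedSetWith m T A' a ∧
        m.real A - η ≤ m.real A') ∧
    ((∃ A : Set X, WeakPDE.IsLimitedSet m T A) → WeakPDE.WeaklyPointwiseDualErgodic m T) := by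
  refine ⟨fun A f a hA hf ha hmeas hsup η hη =>
    WeakPDE.exists_isLimitedSetWith hcons herg hA hf ha hmeas hsup hη, ?_⟩
  rintro ⟨A, a, h⟩
  exact h.weaklyPointwiseDualErgodic hcons herg
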